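/- For $n\ge 1$ let $SYT_n$ be the set of standard Young tableaux with $n$ cells (English notation). For $w\in S_n$ let $I(w)$ be the Robinson–Schensted (row) insertion tableau of the word $w_1\cdots w_n$, and for $T\in SYT_n$ let $\mathcal Y_T=\{w\in S_n : I(w)=T\}$. Let $\le_{weak}$ on $S_n$ be the right weak order, i.e. the reflexive transitive closure of the relation $u\le u s_i$ whenever $s_i=(i,i+1)$ and $\ell(us_i)=\ell(u)+1$. The weak order $\le_{weak}$ on $SYT_n$ is the transitive closure of the relation: $S\le T$ if there are $\sigma\in\mathcal Y_S$ and $\tau\in\mathcal Y_T$ with $\sigma\le_{weak}\tau$. For $k<n$ and $R\in SYT_k$ let $SYT_n^R$ be the set of all $T\in SYT_n$ whose restriction $T_{[1,k]}$ to the cells with entries $1,\dots,k$ is $R$, with the order induced from $SYT_n$. For $R,R'\in SYT_k$ of the same shape, let $\mathcal V_{[R,R']}:SYT_n^R\to SYT_n^{R'}$ be the map that replaces the inner tableau $R$ of $T$ by $R'$ and leaves the other entries unchanged. Write $\lessdot_{weak}$ for the covering relation. **Lemma.** Let $R\in SYT_3$ be the tableau with first row $1,3$ and second row $2$, and let $R'\in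 SYT_3$ be the tableau with first row $1,2$ and second row $3$. Let $n>3$ and $S,T\in SYT_n^{R}$. Then $S\lessdot_{weak}T$ in $SYT_n^{R}$ if and only if $\mathcal V_{[R,R']}(S)\lessdot_{weak}\mathcal V_{[R,R']}(T)$ in $SYT_n^{R'}$. -/

import Mathlib

/-- A standard Young tableau with `n` cells (English convention, rows and columns indexed from `0`):
a Young diagram whose cells carry each of `1, …, n` exactly once, increasing along rows and down
columns.  Outside the shape the entry is `0`. -/
@[ext]
structure StdYoungTableau (n : ℕ) where
  shape : YoungDiagram
  entry : ℕ → ℕ → ℕ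
  row_strict : ∀ {i j₁ j₂ : ℕ}, j₁ < j₂ → (i, j₂) ∈ shape → entry i j₁ < entry i j₂
  col_strict : ∀ {i₁ i₂ j : ℕ}, i₁ < i₂ → (i₂, j) ∈ shape → entry i₁ j < entry i₂ j
  bijOn : Set.BijOn (fun c : ℕ × ℕ => entry c.1 c.2) (shape.cells : Set (ℕ × ℕ)) (Set.Icc 1 n)
  zeros : ∀ {i j : ℕ}, (i, j) ∉ shape → entry i j = 0

/-! ### The right weak order on permutations -/

/-- `s` is one of the adjacent transpositions `s_i = (i, i + 1)` of `S_n`. -/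
def IsAdjTransposition {n : ℕ} (s : Equiv.Perm (Fin n)) : Prop :=
  ∃ (i : ℕ) (h : i + 1 < n), s = Equiv.swap ⟨i, Nat.lt_of_succ_lt h⟩ ⟨i + 1, h⟩

/-- The length of `w`: the size of a reduced (shortest) word in the adjacent transpositions. -/
noncomputable def permLength {n : ℕ} (w : Equiv.Perm (Fin n)) : ℕ :=
  sInf {m : ℕ | ∃ l : List (Equiv.Perm (Fin n)),
    (∀ s ∈ l, IsAdjTransposition s) ∧ l.prod = w ∧ l.length = m}

/-- The right weak order on `S_n`: the reflexive transitive closure of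
`u ≤ u * s_i` whenever `len (u * s_i) = len u + 1`. -/
def PermWeakLE {n : ℕ} : Equiv.Perm (Fin n) → Equiv.Perm (Fin n) → Prop :=
  Relation.ReflTransGen fun u w =>
    ∃ s, IsAdjTransposition s ∧ w = u * s ∧ permLength w = permLength u + 1

/-! ### Robinson-Schensted insertion and Knuth classes -/

/-- Insert `x` into an increasing row: `x` replaces the smallest entry greater than `x`, which is
returned as the bumped entry; if there is none, `x` is appended at the end. -/
def rowInsert (x : ℕ) : List ℕ → List ℕ × Option ℕ
  | [] => ([x], none)
  | a :: l => if x < a then (x :: l, some a) else (a :: (rowInsert x l).1, (rowInsert x l).2)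

/-- Insert `x` into a tableau given as its list of rows (top row first); a bumped entry is inserted
into the next row. -/
def tableauInsert (x : ℕ) : List (List ℕ) → List (List ℕ)
  | [] => [[x]]
  | r :: rs =>
    (rowInsert x r).1 :: (match (rowInsert x r).2 with
      | none => rs
      | some a => tableauInsert a rs)

/-- The insertion tableau of a word, as its list of rows. -/
def insertionRows (w : List ℕ) : List (List ℕ) :=
  w.foldl (fun t x => tableauInsert x t) []

/-- The one-line word `w_1 … w_n` of a permutation, with letters `1, …, n`. -/
def permWord {n : ℕ} (w : Equiv.Perm (Fin n)) : List ℕ :=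
  List.ofFn fun i => (w i : ℕ) + 1

/-- The entry in cell `(i, j)` of an array given by its rows, and `0` if there is no such cell. -/
def rowsEntry (t : List (List ℕ)) (i j : ℕ) : ℕ :=
  (t.getD i []).getD j 0

namespace StdYoungTableau

/-- The Knuth class of `T`: all permutations whose insertion tableau is `T`. -/
def knuthClass {n : ℕ} (T : StdYoungTableau n) : Set (Equiv.Perm (Fin n)) :=
  {w | ∀ i j, rowsEntry (insertionRows (permWord w)) i j = T.entry i j}

/-- The weak order on standard Young tableaux: the transitive closure of the relation
`σ ≤ τ` for some `σ` in the Knuth class of `S` and some `τ` in the Knuth class of `T`. -/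
instance instPreorder (n : ℕ) : Preorder (StdYoungTableau n) where
  le := Relation.ReflTransGen fun S T =>
    ∃ σ ∈ S.knuthClass, ∃ τ ∈ T.knuthClass, PermWeakLE σ τ
  le_refl _ := Relation.ReflTransGen.refl
  le_trans _ _ _ := Relation.ReflTransGen.trans

/-! ### Inner tableaux -/

theorem entry_mono {n : ℕ} (T : StdYoungTableau n) {c d : ℕ × ℕ} (h : c ≤ d) (hd : d ∈ T.shape) :
    T.entry c.1 c.2 ≤ T.entry d.1 d.2 := by
  obtain ⟨i, j⟩ := c
  obtain ⟨i', j'⟩ := d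
  obtain ⟨h1, h2⟩ := h
  have h1 : i ≤ i' := h1
  have h2 : j ≤ j' := h2
  have hm : (i', j) ∈ T.shape := T.shape.up_left_mem le_rfl h2 hd
  have e1 : T.entry i j ≤ T.entry i' j := by
    rcases h1.eq_or_lt with rfl | h1
    · exact le_rfl
    · exact (T.col_strict h1 hm).le
  have e2 : T.entry i' j ≤ T.entry i' j' := by
    rcases h2.eq_or_lt with rfl | h2
    · exact le_rfl
    · exact (T.row_strict h2 hd).le
  exact e1.trans e2

theorem entry_mem_Icc {n : ℕ} (T : StdYoungTableau n) {i j : ℕ} (h : (i, j) ∈ T.shape) :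
    1 ≤ T.entry i j ∧ T.entry i j ≤ n :=
  T.bijOn.mapsTo (show (i, j) ∈ (T.shape.cells : Set (ℕ × ℕ)) from h)

/-- The inner tableau `T_{[1,k]}`: the cells of `T` with entries in `{1, …, k}`. -/
def restrict {k n : ℕ} (h : k ≤ n) (T : StdYoungTableau n) : StdYoungTableau k where
  shape :=
    { cells := T.shape.cells.filter fun c => T.entry c.1 c.2 ≤ k
      isLowerSet := by
        intro d c hcd hd
        simp only [Finset.coe_filter, Set.mem_ofPred_eq, YoungDiagram.mem_cells] at hd ⊢
        exact ⟨T.shape.isLowerSet hcd hd.1, (T.entry_mono hcd hd.1).trans hd.2⟩ }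
  entry i j := if T.entry i j ≤ k then T.entry i j else 0
  row_strict := by
    intro i j₁ j₂ hj hm
    obtain ⟨hm, hk⟩ := Finset.mem_filter.1 hm
    have := T.row_strict hj hm
    dsimp only at hk
    rw [if_pos hk, if_pos (this.le.trans hk)]
    exact this
  col_strict := by
    intro i₁ i₂ j hi hm
    obtain ⟨hm, hk⟩ := Finset.mem_filter.1 hm
    have := T.col_strict hi hm
    dsimp only at hk
    rw [if_pos hk, if_pos (this.le.trans hk)]
    exact this
  bijOn := by
    refine ⟨?_, ?_, ?_⟩
    · intro c hc
      obtain ⟨hm, hk⟩ := Finset.mem_filter.1 hc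
      dsimp only
      rw [if_pos hk]
      exact ⟨(T.bijOn.mapsTo hm).1, hk⟩
    · intro c hc d hd hcd
      obtain ⟨hm, hk⟩ := Finset.mem_filter.1 hc
      obtain ⟨hm', hk'⟩ := Finset.mem_filter.1 hd
      dsimp only at hcd
      rw [if_pos hk, if_pos hk'] at hcd
      exact T.bijOn.injOn hm hm' hcd
    · intro m hm
      obtain ⟨c, hc, rfl⟩ := T.bijOn.surjOn (show m ∈ Set.Icc 1 n from ⟨hm.1, hm.2.trans h⟩)
      exact ⟨c, Finset.mem_filter.2 ⟨hc, hm.2⟩, if_pos hm.2⟩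
  zeros := by
    intro i j hm
    by_cases hs : (i, j) ∈ T.shape
    · refine if_neg fun hk => hm ?_
      exact Finset.mem_filter.2 ⟨hs, hk⟩
    · rw [T.zeros hs]; simp

theorem mem_restrict_shape {k n : ℕ} (h : k ≤ n) (T : StdYoungTableau n) {i j : ℕ} :
    (i, j) ∈ (T.restrict h).shape ↔ (i, j) ∈ T.shape ∧ T.entry i j ≤ k :=
  Finset.mem_filter

/-- `SYT_n^R`: the tableaux with `n` cells whose inner tableau is `R`, with the induced order. -/
abbrev WithInner {k n : ℕ} (h : k ≤ n) (R : StdYoungTableau k) : Type :=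
  {T : StdYoungTableau n // T.restrict h = R}

/-- The tableau obtained from `T` by replacing its inner tableau `R` with `R'` of the same shape. -/
def replaceInner {k n : ℕ} (h : k ≤ n) {R R' : StdYoungTableau k} (hs : R.shape = R'.shape)
    (T : WithInner h R) : StdYoungTableau n :=
  have key : ∀ {i j : ℕ}, (i, j) ∈ R'.shape ↔ (i, j) ∈ T.1.shape ∧ T.1.entry i j ≤ k := by
    intro i j
    rw [← hs, ← mem_restrict_shape h, T.2]
  { shape := T.1.shape
    entry := fun i j => if T.1.entry i j ≤ k then R'.entry i j else T.1.entry i j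
    row_strict := by
      intro i j₁ j₂ hj hm
      have hlt := T.1.row_strict hj hm
      by_cases h2 : T.1.entry i j₂ ≤ k
      · rw [if_pos h2, if_pos (hlt.le.trans h2)]
        exact R'.row_strict hj (key.2 ⟨hm, h2⟩)
      · rw [if_neg h2]
        split_ifs with h1
        · have := (R'.entry_mem_Icc (key.2 ⟨T.1.shape.up_left_mem le_rfl hj.le hm, h1⟩)).2
          omega
        · exact hlt
    col_strict := by
      intro i₁ i₂ j hi hm
      have hlt := T.1.col_strict hi hm
      by_cases h2 : T.1.entry i₂ j ≤ k
      · rw [if_pos h2, if_pos (hlt.le.trans h2)]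
        exact R'.col_strict hi (key.2 ⟨hm, h2⟩)
      · rw [if_neg h2]
        split_ifs with h1
        · have := (R'.entry_mem_Icc (key.2 ⟨T.1.shape.up_left_mem hi.le le_rfl hm, h1⟩)).2
          omega
        · exact hlt
    bijOn := by
      refine ⟨?_, ?_, ?_⟩
      · intro c hc
        dsimp only
        split_ifs with h1
        · have := R'.entry_mem_Icc (key.2 ⟨hc, h1⟩)
          exact ⟨this.1, this.2.trans h⟩
        · exact T.1.bijOn.mapsTo hc
      · intro c hc d hd hcd
        dsimp only at hcd
        split_ifs at hcd with h1 h2 h2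
        · exact R'.bijOn.injOn (key.2 ⟨hc, h1⟩) (key.2 ⟨hd, h2⟩) hcd
        · have := (R'.entry_mem_Icc (key.2 ⟨hc, h1⟩)).2
          omega
        · have := (R'.entry_mem_Icc (key.2 ⟨hd, h2⟩)).2
          omega
        · exact T.1.bijOn.injOn hc hd hcd
      · intro m hm
        by_cases hk : m ≤ k
        · obtain ⟨c, hc, rfl⟩ := R'.bijOn.surjOn (show m ∈ Set.Icc 1 k from ⟨hm.1, hk⟩)
          have hc' := key.1 (show (c.1, c.2) ∈ R'.shape from hc)
          exact ⟨c, hc'.1, if_pos hc'.2⟩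
        · obtain ⟨c, hc, rfl⟩ := T.1.bijOn.surjOn hm
          exact ⟨c, hc, if_neg hk⟩
    zeros := by
      intro i j hm
      rw [T.1.zeros hm, if_pos (Nat.zero_le k)]
      exact R'.zeros fun hR => hm (key.1 hR).1 }

theorem restrict_replaceInner {k n : ℕ} (h : k ≤ n) {R R' : StdYoungTableau k}
    (hs : R.shape = R'.shape) (T : WithInner h R) :
    (replaceInner h hs T).restrict h = R' := by
  have key : ∀ {i j : ℕ}, (i, j) ∈ R'.shape ↔ (i, j) ∈ T.1.shape ∧ T.1.entry i j ≤ k := by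
    intro i j
    rw [← hs, ← mem_restrict_shape h, T.2]
  have hle : ∀ i j, R'.entry i j ≤ k := by
    intro i j
    by_cases hm : (i, j) ∈ R'.shape
    · exact (R'.entry_mem_Icc hm).2
    · rw [R'.zeros hm]; exact Nat.zero_le k
  have hiff : ∀ i j, (replaceInner h hs T).entry i j ≤ k ↔ T.1.entry i j ≤ k := by
    intro i j
    change (if T.1.entry i j ≤ k then R'.entry i j else T.1.entry i j) ≤ k ↔ _
    split_ifs with h1
    · simp [h1, hle i j]
    · rfl
  refine StdYoungTableau.ext ?_ ?_
  · ext ⟨i, j⟩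
    rw [YoungDiagram.mem_cells, YoungDiagram.mem_cells, mem_restrict_shape, hiff, key]
    rfl
  · funext i j
    change (if (replaceInner h hs T).entry i j ≤ k then (replaceInner h hs T).entry i j else 0) = _
    by_cases h1 : T.1.entry i j ≤ k
    · rw [if_pos ((hiff i j).2 h1)]
      exact if_pos h1
    · rw [if_neg (mt (hiff i j).1 h1)]
      exact (R'.zeros fun hR => h1 (key.1 hR).2).symm

/-- The inner tableau translation map `V_{[R,R']} : SYT_n^R → SYT_n^{R'}`. -/
def innerTranslation {k n : ℕ} (h : k ≤ n) {R R' : StdYoungTableau k} (hs : R.shape = R'.shape)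
    (T : WithInner h R) : WithInner h R' :=
  ⟨replaceInner h hs T, restrict_replaceInner h hs T⟩

/-! ### The two tableaux of shape `(2, 1)` -/

/-- The Young diagram of the partition `(2, 1)`. -/
def diagram21 : YoungDiagram where
  cells := {(0, 0), (0, 1), (1, 0)}
  isLowerSet := by
    rintro ⟨a, b⟩ ⟨c, d⟩ ⟨h1, h2⟩ hm
    simp only [Finset.coe_insert, Finset.coe_singleton, Set.mem_insert_iff,
      Set.mem_singleton_iff, Prod.mk.injEq] at hm ⊢
    simp only at h1 h2
    omega

theorem mem_diagram21 {i j : ℕ} :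
    (i, j) ∈ diagram21 ↔ (i = 0 ∧ j = 0) ∨ (i = 0 ∧ j = 1) ∨ (i = 1 ∧ j = 0) := by
  rw [← YoungDiagram.mem_cells]
  simp [diagram21]

/-- The tableau of shape `(2, 1)` with first row `1, a` and second row `b`, where
`{a, b} = {2, 3}`. -/
def tableau21 (a b : ℕ) (hab : (a = 2 ∧ b = 3) ∨ (a = 3 ∧ b = 2)) : StdYoungTableau 3 where
  shape := diagram21
  entry i j :=
    if i = 0 ∧ j = 0 then 1 else if i = 0 ∧ j = 1 then a else if i = 1 ∧ j = 0 then b else 0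
  row_strict := by
    intro i j₁ j₂ hj hm
    rw [mem_diagram21] at hm
    have h : i = 0 ∧ j₁ = 0 ∧ j₂ = 1 := by omega
    obtain ⟨rfl, rfl, rfl⟩ := h
    simp
    omega
  col_strict := by
    intro i₁ i₂ j hi hm
    rw [mem_diagram21] at hm
    have h : i₁ = 0 ∧ i₂ = 1 ∧ j = 0 := by omega
    obtain ⟨rfl, rfl, rfl⟩ := h
    simp
    omega
  bijOn := by
    refine ⟨?_, ?_, ?_⟩
    · rintro ⟨i, j⟩ hc
      have hc := mem_diagram21.1 hc
      simp only [Set.mem_Icc]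
      split_ifs <;> omega
    · rintro ⟨i, j⟩ hc ⟨i', j'⟩ hd hcd
      have hc := mem_diagram21.1 hc
      have hd := mem_diagram21.1 hd
      simp only at hcd
      rw [Prod.mk.injEq]
      split_ifs at hcd <;> omega
    · intro m hm
      have hm : m = 1 ∨ m = a ∨ m = b := by
        have := hm.1
        have := hm.2
        omega
      rcases hm with rfl | rfl | rfl
      · exact ⟨(0, 0), mem_diagram21.2 (by simp), by simp⟩
      · exact ⟨(0, 1), mem_diagram21.2 (by simp), by simp⟩
      · exact ⟨(1, 0), mem_diagram21.2 (by simp), by simp⟩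
  zeros := by
    intro i j hm
    rw [mem_diagram21] at hm
    rw [if_neg (by tauto), if_neg (by tauto), if_neg (by tauto)]

/-- The tableau with first row `1, 3` and second row `2`. -/
def tableau13_2 : StdYoungTableau 3 := tableau21 3 2 (Or.inr ⟨rfl, rfl⟩)

/-- The tableau with first row `1, 2` and second row `3`. -/
def tableau12_3 : StdYoungTableau 3 := tableau21 2 3 (Or.inl ⟨rfl, rfl⟩)

theorem shape_tableau13_2 : tableau13_2.shape = tableau12_3.shape := rfl

end StdYoungTableau

/-! The order on tableaux is first turned into a preorder on words. Two permutation words have the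
same insertion tableau exactly when they are Knuth equivalent: `KnuthStep.insertionRows_eq` gives
one direction and `knuthEq_readingWord` the other. Length equals the number of inversions
(`permLength_eq`). Hence `le_iff_wordLE`: comparing two tableaux means joining their reading words
by a path of ascending adjacent swaps and Knuth moves, the latter in either direction.

Words whose restriction to the letters 1, 2, 3 is 213 or 231 have inner tableau `tableau13_2`. On
them `dualKnuth` exchanges 2 and 3 in the first case and 1 and 2 in the second, giving 312 and 132,
the two words of `tableau12_3`. The reading word of a tableau in the domain restricts to 213, so
there `dualKnuth` is exactly inner translation. It remains to see that `dualKnuth` preserves and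
reflects the preorder.

A path between two inner words never leaves them, because an upward step can only lead on to 321,
which is absorbing. A step that keeps the small subword relabels both ends by the same exchange of
two consecutive values. These values are not adjacent in the subword, so the step survives. The real
case is the weak step 213 → 231, whose duals need not be related by a single weak step
(`dualKnuth_wordLE_of_swap`). There the prefix ending before the exchanged letters is replaced, up
to Knuth equivalence, by ρ2r with 2r increasing. If r is empty the step is a Knuth move and so is
its dual. If r = br', both words are brought to a form in which the duals differ by the single
ascending swap 3b → b3.

For the converse, reversing words reverses the preorder, and `dualKnuth` followed by reversal is an
involution on inner words. The forward direction, applied to the reversed duals, therefore gives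
reflection. A bijection that preserves and reflects ≤ preserves and reflects covers. -/

/-! ### Knuth relations on words -/

/-- An elementary Knuth relation, oriented so that it raises the number of inversions. -/
inductive KnuthStep : List ℕ → List ℕ → Prop
  | left (α γ : List ℕ) {x y z : ℕ} (hxy : x < y) (hyz : y < z) :
      KnuthStep (α ++ y :: x :: z :: γ) (α ++ y :: z :: x :: γ)
  | right (α γ : List ℕ) {x y z : ℕ} (hxy : x < y) (hyz : y < z) :
      KnuthStep (α ++ x :: z :: y :: γ) (α ++ z :: x :: y :: γ)

/-- Knuth equivalence of words. -/
abbrev KnuthEq : List ℕ → List ℕ → Prop := Relation.EqvGen KnuthStep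

theorem KnuthStep.append {u v : List ℕ} (h : KnuthStep u v) (p s : List ℕ) :
    KnuthStep (p ++ u ++ s) (p ++ v ++ s) := by
  cases h with
  | left α γ hxy hyz => simpa using KnuthStep.left (p ++ α) (γ ++ s) hxy hyz
  | right α γ hxy hyz => simpa using KnuthStep.right (p ++ α) (γ ++ s) hxy hyz

theorem KnuthStep.perm {u v : List ℕ} (h : KnuthStep u v) : u.Perm v := by
  cases h with
  | left α γ => exact List.Perm.append_left _ (.cons _ (.swap ..))
  | right α γ => exact List.Perm.append_left _ (.swap ..)

theorem KnuthEq.trans {u v w : List ℕ} (h : KnuthEq u v) (h' : KnuthEq v w) : KnuthEq u w :=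
  Relation.EqvGen.trans _ _ _ h h'

theorem KnuthEq.symm {u v : List ℕ} (h : KnuthEq u v) : KnuthEq v u :=
  Relation.EqvGen.symm _ _ h

theorem KnuthEq.append {u v : List ℕ} (h : KnuthEq u v) (p s : List ℕ) :
    KnuthEq (p ++ u ++ s) (p ++ v ++ s) := by
  induction h with
  | rel u v h => exact .rel _ _ (h.append p s)
  | refl u => exact .refl _
  | symm u v _ ih => exact ih.symm
  | trans u v w _ _ ih ih' => exact ih.trans ih'

theorem KnuthEq.append_left {u v : List ℕ} (h : KnuthEq u v) (p : List ℕ) :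
    KnuthEq (p ++ u) (p ++ v) := by
  simpa using h.append p []

theorem KnuthEq.append_right {u v : List ℕ} (h : KnuthEq u v) (s : List ℕ) :
    KnuthEq (u ++ s) (v ++ s) := h.append [] s

theorem KnuthEq.cons {u v : List ℕ} (h : KnuthEq u v) (a : ℕ) :
    KnuthEq (a :: u) (a :: v) := h.append_left [a]

theorem KnuthEq.perm {u v : List ℕ} (h : KnuthEq u v) : u.Perm v := by
  induction h with
  | rel u v h => exact h.perm
  | refl u => exact .refl _
  | symm u v _ ih => exact ih.symm
  | trans u v w _ _ ih ih' => exact ih.trans ih'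

/-! ### Row insertion -/

theorem rowInsert_cons (x a : ℕ) (l : List ℕ) : rowInsert x (a :: l) =
    if x < a then (x :: l, some a) else (a :: (rowInsert x l).1, (rowInsert x l).2) := rfl

theorem rowInsert_cons_of_lt {x a : ℕ} (h : x < a) (l : List ℕ) :
    rowInsert x (a :: l) = (x :: l, some a) := if_pos h

theorem rowInsert_cons_of_le {x a : ℕ} (h : a ≤ x) (l : List ℕ) :
    rowInsert x (a :: l) = (a :: (rowInsert x l).1, (rowInsert x l).2) := if_neg h.not_gt

theorem rowInsert_perm (x : ℕ) (r : List ℕ) :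
    ((rowInsert x r).2.toList ++ (rowInsert x r).1).Perm (r ++ [x]) := by
  induction r with
  | nil => simp [rowInsert]
  | cons a l ih =>
    rw [rowInsert_cons]
    split_ifs with h
    · simp only [Option.toList_some, List.cons_append]
      exact .cons _ (List.perm_append_singleton x l).symm
    · exact List.perm_middle.trans (.cons a ih)

theorem mem_rowInsert {x y : ℕ} {r : List ℕ} (h : y ∈ (rowInsert x r).1) : y = x ∨ y ∈ r := by
  have := (rowInsert_perm x r).mem_iff.1 (List.mem_append_right _ h)
  simp only [List.mem_append, List.mem_singleton] at this
  tauto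

theorem self_mem_rowInsert (x : ℕ) (r : List ℕ) : x ∈ (rowInsert x r).1 := by
  induction r with
  | nil => simp [rowInsert]
  | cons a l ih => rw [rowInsert_cons]; split_ifs <;> simp [ih]

theorem rowInsert_bump {x b : ℕ} {r : List ℕ} (h : (rowInsert x r).2 = some b) :
    x < b ∧ b ∈ r := by
  induction r with
  | nil => simp [rowInsert] at h
  | cons a l ih =>
    rw [rowInsert_cons] at h
    split_ifs at h with hx
    · obtain rfl : a = b := by simpa using h
      simp [hx]
    · exact ⟨(ih h).1, List.mem_cons_of_mem _ (ih h).2⟩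

theorem rowInsert_sorted {r : List ℕ} (h : r.Pairwise (· ≤ ·)) (x : ℕ) :
    (rowInsert x r).1.Pairwise (· ≤ ·) := by
  induction r with
  | nil => simp [rowInsert]
  | cons a l ih =>
    rw [List.pairwise_cons] at h
    rw [rowInsert_cons]
    split_ifs with hx
    · exact List.pairwise_cons.2 ⟨fun b hb => hx.le.trans (h.1 b hb), h.2⟩
    · refine List.pairwise_cons.2 ⟨fun b hb => ?_, ih h.2⟩
      rcases mem_rowInsert hb with rfl | hb
      · omega
      · exact h.1 b hb

theorem exists_bump_of_mem {y z : ℕ} {r : List ℕ} (h : r.Pairwise (· ≤ ·)) (hyz : y < z)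
    (hz : z ∈ r) : ∃ b, (rowInsert y r).2 = some b ∧ b ≤ z := by
  induction r with
  | nil => simp at hz
  | cons a l ih =>
    rw [List.pairwise_cons] at h
    rw [rowInsert_cons]
    split_ifs with hx
    · refine ⟨a, rfl, ?_⟩
      rcases List.mem_cons.1 hz with rfl | hz
      · exact le_rfl
      · exact h.1 z hz
    · rcases List.mem_cons.1 hz with rfl | hz
      · omega
      · exact ih h.2 hz

/-- Inserting `y` and then `z ≥ y` into a row: the second bumped letter is at least the first. -/
theorem rowInsert_bump_mono {y z : ℕ} {r : List ℕ} (h : r.Pairwise (· ≤ ·)) (hyz : y ≤ z) :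
    (rowInsert z (rowInsert y r).1).2 = none ∨ ∃ b c, (rowInsert y r).2 = some b ∧
      (rowInsert z (rowInsert y r).1).2 = some c ∧ b ≤ c := by
  induction r with
  | nil => left; simp [rowInsert, hyz.not_gt]
  | cons a l ih =>
    rw [List.pairwise_cons] at h
    rcases lt_or_ge y a with hy | hy
    · rw [rowInsert_cons_of_lt hy, rowInsert_cons_of_le hyz]
      rcases hc : (rowInsert z l).2 with _ | c
      · exact .inl rfl
      · exact .inr ⟨a, c, rfl, rfl, h.1 c (rowInsert_bump hc).2⟩
    · rw [rowInsert_cons_of_le hy, rowInsert_cons_of_le (hy.trans hyz)]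
      exact ih h.2

/-- The row obtained by inserting a word into a row, and the word of bumped letters. -/
def rowInsertWord : List ℕ → List ℕ → List ℕ × List ℕ
  | r, [] => (r, [])
  | r, x :: w => ((rowInsertWord (rowInsert x r).1 w).1,
      (rowInsert x r).2.toList ++ (rowInsertWord (rowInsert x r).1 w).2)

theorem tableauInsert_cons (x : ℕ) (r : List ℕ) (rs : List (List ℕ)) :
    tableauInsert x (r :: rs) = (rowInsert x r).1 ::
      (rowInsert x r).2.toList.foldl (fun t x => tableauInsert x t) rs := by
  rw [tableauInsert]
  cases (rowInsert x r).2 <;> rfl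

theorem foldl_tableauInsert_cons (w r : List ℕ) (rs : List (List ℕ)) :
    w.foldl (fun t x => tableauInsert x t) (r :: rs) = (rowInsertWord r w).1 ::
      (rowInsertWord r w).2.foldl (fun t x => tableauInsert x t) rs := by
  induction w generalizing r rs with
  | nil => rfl
  | cons x w ih =>
    rw [List.foldl_cons, tableauInsert_cons, ih]
    simp [rowInsertWord, List.foldl_append]

/-- The Knuth relations for words with repeated letters, on words of length three. -/
inductive WeakKnuth : List ℕ → List ℕ → Prop
  | left {x y z : ℕ} (hxy : x < y) (hyz : y ≤ z) : WeakKnuth [y, x, z] [y, z, x]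
  | right {x y z : ℕ} (hxy : x ≤ y) (hyz : y < z) : WeakKnuth [x, z, y] [z, x, y]

/-- A Knuth relation survives passage through one row, which allows induction over rows. Working
with weak inequalities means that only sortedness of the rows has to be carried along, not
distinctness of letters. If z bumps nothing, the bumped words coincide. -/
theorem rowInsertWord_left {r : List ℕ} (hr : r.Pairwise (· ≤ ·)) {x y z : ℕ} (hxy : x < y)
    (hyz : y ≤ z) : (rowInsertWord r [y, x, z]).1 = (rowInsertWord r [y, z, x]).1 ∧
      ((rowInsertWord r [y, x, z]).2 = (rowInsertWord r [y, z, x]).2 ∨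
        WeakKnuth (rowInsertWord r [y, x, z]).2 (rowInsertWord r [y, z, x]).2) := by
  have hxz : x ≤ z := hxy.le.trans hyz
  induction r with
  | nil => simp [rowInsertWord, rowInsert, hxy, hyz.not_gt, hxz.not_gt]
  | cons a l ih =>
    rw [List.pairwise_cons] at hr
    rcases lt_or_ge y a with hy | hy
    · simp only [rowInsertWord, rowInsert_cons_of_lt hy, rowInsert_cons_of_lt hxy,
        rowInsert_cons_of_le hyz, rowInsert_cons_of_le hxz, true_and]
      rcases hc : (rowInsert z l).2 with _ | c
      · left; simp
      · right; simpa using WeakKnuth.left hy (hr.1 c (rowInsert_bump hc).2)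
    · rcases lt_or_ge x a with hx | hx
      · simp only [rowInsertWord, rowInsert_cons_of_le hy, rowInsert_cons_of_lt hx,
          rowInsert_cons_of_le hxz, rowInsert_cons_of_le (hy.trans hyz), true_and]
        rcases rowInsert_bump_mono hr.2 hyz with hc | ⟨b, c, hb, hc, hbc⟩
        · left; simp [hc]
        · right
          rw [hb, hc]
          simpa using WeakKnuth.left (hy.trans_lt (rowInsert_bump hb).1) hbc
      · simpa [rowInsertWord, rowInsert_cons_of_le hy, rowInsert_cons_of_le hx,
          rowInsert_cons_of_le (hx.trans hxz)] using ih hr.2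

/-- The relation between the bumped words may change type and orientation: if x and z both lie below
the first entry a, the words are a f z and a z f, with f the next entry, a relation of the other
kind. Hence the two separate alternatives. -/
theorem rowInsertWord_right {r : List ℕ} (hr : r.Pairwise (· ≤ ·)) {x y z : ℕ} (hxy : x ≤ y)
    (hyz : y < z) : (rowInsertWord r [x, z, y]).1 = (rowInsertWord r [z, x, y]).1 ∧
      ((rowInsertWord r [x, z, y]).2 = (rowInsertWord r [z, x, y]).2 ∨
        WeakKnuth (rowInsertWord r [z, x, y]).2 (rowInsertWord r [x, z, y]).2 ∨
        WeakKnuth (rowInsertWord r [x, z, y]).2 (rowInsertWord r [z, x, y]).2) := by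
  have hxz : x < z := hxy.trans_lt hyz
  induction r with
  | nil => simp [rowInsertWord, rowInsert, hyz, hxz, hxy.not_gt, hxz.not_gt]
  | cons a l ih =>
    rw [List.pairwise_cons] at hr
    rcases lt_or_ge x a with hx | hx
    · rcases lt_or_ge z a with hz | hz
      · simp only [rowInsertWord, rowInsert_cons_of_lt hx, rowInsert_cons_of_lt hz,
          rowInsert_cons_of_le hxz.le, rowInsert_cons_of_lt hxz, rowInsert_cons_of_le hxy]
        cases l with
        | nil => simp [rowInsert, hyz]
        | cons f l =>
          have hf : a ≤ f := hr.1 f (by simp)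
          rw [rowInsert_cons_of_lt (hz.trans_le hf), rowInsert_cons_of_lt
            ((hyz.trans hz).trans_le hf), rowInsert_cons_of_lt hyz]
          exact ⟨rfl, .inr (.inl (WeakKnuth.left hz hf))⟩
      · simp only [rowInsertWord, rowInsert_cons_of_lt hx, rowInsert_cons_of_le hz,
          rowInsert_cons_of_le hxz.le, rowInsert_cons_of_le hxy, true_and]
        -- The letter z has just been placed in the tail, so y bumps some b ≤ z, below whatever z
        -- bumped.
        obtain ⟨b, hb, hbz⟩ := exists_bump_of_mem (rowInsert_sorted hr.2 z) hyz
          (self_mem_rowInsert z l)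
        rw [hb]
        rcases hc : (rowInsert z l).2 with _ | c
        · left; simp
        · right; right
          refine WeakKnuth.right ?_ (hbz.trans_lt (rowInsert_bump hc).1)
          rcases mem_rowInsert (rowInsert_bump hb).2 with rfl | h
          · exact hz
          · exact hr.1 _ h
    · simpa [rowInsertWord, rowInsert_cons_of_le hx, rowInsert_cons_of_le (hx.trans hxz.le),
          rowInsert_cons_of_le (hx.trans hxy)] using ih hr.2

theorem WeakKnuth.foldl_eq {u v : List ℕ} (h : WeakKnuth u v) {t : List (List ℕ)}
    (ht : ∀ r ∈ t, r.Pairwise (· ≤ ·)) :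
    u.foldl (fun t x => tableauInsert x t) t = v.foldl (fun t x => tableauInsert x t) t := by
  induction t generalizing u v with
  | nil =>
    cases h with
    | left hxy hyz =>
      simp [tableauInsert, rowInsert, hxy, hyz.not_gt, (hxy.trans_le hyz).not_gt]
    | right hxy hyz =>
      simp [tableauInsert, rowInsert, hyz, hxy.not_gt, (hxy.trans_lt hyz),
        (hxy.trans_lt hyz).not_gt]
  | cons r rs ih =>
    have hr := ht r (by simp)
    have hrs : ∀ r ∈ rs, r.Pairwise (· ≤ ·) := fun r h => ht r (by simp [h])
    rw [foldl_tableauInsert_cons, foldl_tableauInsert_cons]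
    cases h with
    | left hxy hyz =>
      obtain ⟨h1, h2 | h2⟩ := rowInsertWord_left hr hxy hyz
      · rw [h1, h2]
      · rw [h1, ih h2 hrs]
    | right hxy hyz =>
      obtain ⟨h1, h2 | h2 | h2⟩ := rowInsertWord_right hr hxy hyz
      · rw [h1, h2]
      · rw [h1, ih h2 hrs]
      · rw [h1, ih h2 hrs]

/-! ### Tableaux as lists of rows -/

/-- The row `r` may be placed on top of the row `r'` in a column-strict tableau. -/
def RowAbove : List ℕ → List ℕ → Prop
  | _, [] => True
  | [], _ :: _ => False
  | a :: r, b :: r' => a < b ∧ RowAbove r r'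

/-- A semistandard tableau, given by the list of its rows. -/
def IsTableau : List (List ℕ) → Prop
  | [] => True
  | r :: rs => r ≠ [] ∧ r.Pairwise (· ≤ ·) ∧ (∀ r' ∈ rs.head?, RowAbove r r') ∧ IsTableau rs

theorem IsTableau.sorted {t : List (List ℕ)} (h : IsTableau t) :
    ∀ r ∈ t, r.Pairwise (· ≤ ·) := by
  induction t with
  | nil => simp
  | cons r rs ih =>
    intro r' hr'
    rcases List.mem_cons.1 hr' with rfl | hr'
    · exact h.2.1
    · exact ih h.2.2.2 r' hr'

theorem RowAbove.rowInsert {r r' : List ℕ} (h : RowAbove r r') (x : ℕ) :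
    RowAbove (rowInsert x r).1 r' := by
  induction r generalizing r' with
  | nil => cases r' with
    | nil => simp [RowAbove]
    | cons => exact h.elim
  | cons a r ih => cases r' with
    | nil => simp [RowAbove]
    | cons b r' =>
      rw [rowInsert_cons]
      split_ifs with hx
      · exact ⟨hx.trans h.1, h.2⟩
      · exact ⟨h.1, ih h.2⟩

/-- A bumped letter lands in the next row weakly to the left of the column it came from, since it is
smaller than the entry below its old place. So columns stay strict. -/
theorem RowAbove.rowInsert_bump {r r' : List ℕ} (h : RowAbove r r') {x y : ℕ}
    (hy : (_root_.rowInsert x r).2 = some y) :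
    RowAbove (_root_.rowInsert x r).1 (_root_.rowInsert y r').1 := by
  induction r generalizing r' with
  | nil => simp [_root_.rowInsert] at hy
  | cons a r ih =>
    have hxy := (_root_.rowInsert_bump hy).1
    rw [rowInsert_cons] at hy ⊢
    split_ifs at hy ⊢ with hx
    · obtain rfl : a = y := by simpa using hy
      cases r' with
      | nil => simp [_root_.rowInsert, RowAbove, hx]
      | cons b r' =>
        rw [rowInsert_cons_of_lt h.1]
        exact ⟨hx, h.2⟩
    · cases r' with
      | nil =>
        refine ⟨by omega, ?_⟩
        simp [RowAbove]
      | cons b r' =>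
        rw [rowInsert_cons]
        split_ifs with hb
        · exact ⟨by omega, h.2.rowInsert x⟩
        · exact ⟨h.1, ih h.2 hy⟩

theorem rowInsert_ne_nil (x : ℕ) (r : List ℕ) : (rowInsert x r).1 ≠ [] :=
  List.ne_nil_of_mem (self_mem_rowInsert x r)

theorem IsTableau.tableauInsert {t : List (List ℕ)} (h : IsTableau t) (x : ℕ) :
    IsTableau (tableauInsert x t) := by
  induction t generalizing x with
  | nil => simp [_root_.tableauInsert, IsTableau]
  | cons r rs ih =>
    obtain ⟨-, h2, h3, h4⟩ := h
    rw [_root_.tableauInsert]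
    rcases hb : (rowInsert x r).2 with _ | b
    · exact ⟨rowInsert_ne_nil x r, rowInsert_sorted h2 x, fun r' hr' => (h3 r' hr').rowInsert x, h4⟩
    · refine ⟨rowInsert_ne_nil x r, rowInsert_sorted h2 x, fun r' hr' => ?_, ih h4 b⟩
      cases rs with
      | nil =>
        obtain rfl : [b] = r' := by simpa [_root_.tableauInsert] using hr'
        exact RowAbove.rowInsert_bump (r' := []) (by simp [RowAbove]) hb
      | cons s ss =>
        dsimp only at hr'
        rw [tableauInsert_cons] at hr'
        obtain rfl : (rowInsert b s).1 = r' := by simpa using hr'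
        exact (h3 s (by simp)).rowInsert_bump hb

theorem isTableau_foldl (w : List ℕ) {t : List (List ℕ)} (h : IsTableau t) :
    IsTableau (w.foldl (fun t x => tableauInsert x t) t) := by
  induction w generalizing t with
  | nil => exact h
  | cons x w ih => exact ih (h.tableauInsert x)

theorem isTableau_insertionRows (w : List ℕ) : IsTableau (insertionRows w) :=
  isTableau_foldl w trivial

theorem KnuthStep.insertionRows_eq {u v : List ℕ} (h : KnuthStep u v) :
    insertionRows u = insertionRows v := by
  have key : ∀ (α γ u v : List ℕ), WeakKnuth u v →
      insertionRows (α ++ u ++ γ) = insertionRows (α ++ v ++ γ) := by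
    intro α γ u v h
    simp only [insertionRows, List.foldl_append]
    rw [h.foldl_eq (isTableau_foldl α (t := []) trivial).sorted]
  cases h with
  | left α γ hxy hyz => simpa using key α γ _ _ (.left hxy hyz.le)
  | right α γ hxy hyz => simpa using key α γ _ _ (.right hxy.le hyz)

theorem KnuthEq.insertionRows_eq {u v : List ℕ} (h : KnuthEq u v) :
    insertionRows u = insertionRows v := by
  induction h with
  | rel u v h => exact h.insertionRows_eq
  | refl u => rfl
  | symm u v _ ih => exact ih.symm
  | trans u v w _ _ ih ih' => exact ih.trans ih'

/-! ### Reading words -/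

/-- The reading word of a tableau: its rows from bottom to top. -/
def readingWord : List (List ℕ) → List ℕ
  | [] => []
  | r :: rs => readingWord rs ++ r

theorem readingWord_map (f : ℕ → ℕ) (t : List (List ℕ)) :
    readingWord (t.map (List.map f)) = (readingWord t).map f := by
  induction t with
  | nil => rfl
  | cons r rs ih => simp [readingWord, ih]

theorem readingWord_perm_flatten (t : List (List ℕ)) : (readingWord t).Perm t.flatten := by
  induction t with
  | nil => rfl
  | cons r rs ih =>
    rw [readingWord, List.flatten_cons]
    exact List.perm_append_comm.trans (ih.append_left r)

theorem rowInsertWord_cons {a : ℕ} {w : List ℕ} (h : ∀ x ∈ w, a ≤ x) (l : List ℕ) :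
    rowInsertWord (a :: l) w = (a :: (rowInsertWord l w).1, (rowInsertWord l w).2) := by
  induction w generalizing l with
  | nil => rfl
  | cons x w ih =>
    rw [rowInsertWord, rowInsert_cons_of_le (h x (by simp))]
    dsimp only
    rw [ih (fun y hy => h y (by simp [hy]))]
    rfl

/-- Each letter of the upper row bumps exactly the entry below it, so the lower row is expelled
intact and in order. Iterating this down the tableau shows that a reading word inserts back to its
tableau. -/
theorem RowAbove.rowInsertWord_eq {r r' : List ℕ} (h : RowAbove r r')
    (hr : r.Pairwise (· ≤ ·)) : rowInsertWord r' r = (r, r') := by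
  induction r generalizing r' with
  | nil => cases r' with
    | nil => rfl
    | cons => exact h.elim
  | cons a r ih =>
    rw [List.pairwise_cons] at hr
    cases r' with
    | nil =>
      simp only [rowInsertWord, _root_.rowInsert, rowInsertWord_cons hr.1]
      rw [ih (r' := []) (by simp [RowAbove]) hr.2]
      rfl
    | cons b r' =>
      simp only [rowInsertWord, rowInsert_cons_of_lt h.1, rowInsertWord_cons hr.1]
      rw [ih h.2 hr.2]
      rfl

theorem IsTableau.foldl_head {r : List ℕ} {rs : List (List ℕ)} (h : IsTableau (r :: rs)) :
    r.foldl (fun t x => _root_.tableauInsert x t) rs = r :: rs := by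
  induction rs generalizing r with
  | nil =>
    obtain ⟨h1, h2, -, -⟩ := h
    cases r with
    | nil => exact (h1 rfl).elim
    | cons a r =>
      rw [List.pairwise_cons] at h2
      rw [List.foldl_cons, _root_.tableauInsert, foldl_tableauInsert_cons,
        rowInsertWord_cons h2.1,
        RowAbove.rowInsertWord_eq (r' := []) (by simp [RowAbove]) h2.2]
      rfl
  | cons s ss ih =>
    rw [foldl_tableauInsert_cons, (h.2.2.1 s (by simp)).rowInsertWord_eq h.2.1, ih h.2.2.2]

theorem IsTableau.insertionRows_readingWord {t : List (List ℕ)} (h : IsTableau t) :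
    insertionRows (readingWord t) = t := by
  induction t with
  | nil => rfl
  | cons r rs ih =>
    have := ih h.2.2.2
    unfold insertionRows at this ⊢
    rw [readingWord, List.foldl_append, this, h.foldl_head]

/-- A letter smaller than an increasing run travels left through it by moves y z x → y x z, stopping
after the first letter of the run because a witness y is needed on the left. -/
theorem knuthEq_move_left {a x : ℕ} {l : List ℕ} (hx : x < a)
    (hl : (a :: l).Pairwise (· < ·)) : KnuthEq (a :: (l ++ [x])) (a :: x :: l) := by
  induction l generalizing a with
  | nil => exact .refl _
  | cons b l ih =>
    rw [List.pairwise_cons] at hl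
    have hb : a < b := hl.1 b (by simp)
    refine ((ih (hx.trans hb) hl.2).cons a).trans ?_
    exact KnuthEq.symm (.rel _ _ (KnuthStep.left [] l hx hb))

theorem knuthEq_rowInsert {r : List ℕ} {x : ℕ} (hr : r.Pairwise (· < ·)) (hx : x ∉ r) :
    KnuthEq (r ++ [x]) ((rowInsert x r).2.toList ++ (rowInsert x r).1) := by
  induction r with
  | nil => exact .refl _
  | cons a l ih =>
    rw [rowInsert_cons]
    split_ifs with h
    · exact knuthEq_move_left h hr
    · rw [List.pairwise_cons] at hr
      have hxa : x ≠ a := fun e => hx (by simp [e])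
      have hxl : x ∉ l := fun e => hx (by simp [e])
      refine ((ih hr.2 hxl).cons a).trans ?_
      rcases hb : (rowInsert x l).2 with _ | b
      · exact .refl _
      · obtain ⟨c, s, hcs, hac, hcb⟩ :
            ∃ c s, (rowInsert x l).1 = c :: s ∧ a < c ∧ c < b := by
          cases l with
          | nil => simp [rowInsert] at hb
          | cons d l =>
            have hxb := (rowInsert_bump hb).1
            rw [rowInsert_cons] at hb ⊢
            split_ifs at hb ⊢ with hd
            · exact ⟨x, l, rfl, by omega, hxb⟩
            · exact ⟨d, _, rfl, hr.1 d (by simp), by omega⟩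
        simp only [hcs]
        exact .rel _ _ (KnuthStep.right [] s hac hcb)

theorem knuthEq_tableauInsert {t : List (List ℕ)} {x : ℕ} (ht : ∀ r ∈ t, r.Pairwise (· ≤ ·))
    (hn : (readingWord t ++ [x]).Nodup) :
    KnuthEq (readingWord t ++ [x]) (readingWord (tableauInsert x t)) := by
  induction t generalizing x with
  | nil => exact .refl _
  | cons r rs ih =>
    rw [readingWord, List.append_assoc] at hn ⊢
    have hrx := hn.of_append_right
    have hs : r.Pairwise (· < ·) := ((ht r (by simp)).and hrx.of_append_left).imp
      fun h => lt_of_le_of_ne h.1 h.2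
    have hx : x ∉ r := fun h => (List.nodup_append.1 hrx).2.2 x h x (by simp) rfl
    have h1 := (knuthEq_rowInsert hs hx).append_left (readingWord rs)
    refine h1.trans ?_
    rw [tableauInsert]
    rcases hb : (rowInsert x r).2 with _ | b
    · exact .refl _
    · have h2 := h1.perm.nodup_iff.1 hn
      simp only [hb, Option.toList_some] at h2 ⊢
      rw [← List.append_assoc] at h2 ⊢
      exact (ih (fun r h => ht r (by simp [h])) h2.of_append_left).append_right _

theorem knuthEq_readingWord {w : List ℕ} (hw : w.Nodup) :
    KnuthEq w (readingWord (insertionRows w)) := by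
  induction w using List.reverseRecOn with
  | nil => exact .refl _
  | append_singleton w x ih =>
    have h1 := (ih hw.of_append_left).append_right [x]
    have h2 := knuthEq_tableauInsert (isTableau_insertionRows w).sorted (h1.perm.nodup_iff.1 hw)
    simpa [insertionRows] using h1.trans h2

/-- Row insertion into a single row, with bumped letters collected in ρ. Every letter of ρ has a
smaller one in the row, so the minimum lies in the row, necessarily at its head. -/
theorem exists_knuthEq_append_sorted {w : List ℕ} (hw : w.Nodup) {m : ℕ} (hm : m ∈ w)
    (hmin : ∀ a ∈ w, m ≤ a) :
    ∃ ρ r : List ℕ, KnuthEq w (ρ ++ m :: r) ∧ (m :: r).Pairwise (· < ·) := by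
  have key : ∀ w : List ℕ, w.Nodup → ∃ ρ r : List ℕ, KnuthEq w (ρ ++ r) ∧ r.Pairwise (· < ·) ∧
      ∀ a ∈ ρ, ∃ b ∈ r, b < a := by
    intro w
    induction w using List.reverseRecOn with
    | nil => exact fun _ => ⟨[], [], .refl _, by simp, by simp⟩
    | append_singleton w x ih =>
      intro hw
      obtain ⟨ρ, r, h1, h2, h3⟩ := ih hw.of_append_left
      have h1' := h1.append_right [x]
      have hn := h1'.perm.nodup_iff.1 hw
      rw [List.append_assoc] at hn h1'
      have hrx := hn.of_append_right
      have hx : x ∉ r := fun h => (List.nodup_append.1 hrx).2.2 x h x (by simp) rfl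
      have h4 := knuthEq_rowInsert h2 hx
      have h5 := h4.perm.nodup_iff.1 hrx
      refine ⟨ρ ++ (rowInsert x r).2.toList, (rowInsert x r).1,
        by simpa using h1'.trans (h4.append_left ρ), ?_, ?_⟩
      · exact ((rowInsert_sorted (h2.imp le_of_lt) x).and h5.of_append_right).imp
          fun h => lt_of_le_of_ne h.1 h.2
      · have h6 : ∀ b, (rowInsert x r).2 = some b → ∃ c ∈ (rowInsert x r).1, c < b :=
          fun b hb => ⟨x, self_mem_rowInsert x r, (rowInsert_bump hb).1⟩
        intro a ha
        rcases List.mem_append.1 ha with ha | ha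
        · obtain ⟨b, hb, hba⟩ := h3 a ha
          have := (rowInsert_perm x r).mem_iff.2 (List.mem_append_left [x] hb)
          rcases List.mem_append.1 this with h | h
          · obtain ⟨c, hc, hcb⟩ := h6 b (by simpa using h)
            exact ⟨c, hc, hcb.trans hba⟩
          · exact ⟨b, h, hba⟩
        · exact h6 a (by simpa using ha)
  obtain ⟨ρ, r, h1, h2, h3⟩ := key w hw
  have hmr : m ∈ r := by
    rcases List.mem_append.1 (h1.perm.mem_iff.1 hm) with h | h
    · obtain ⟨b, hb, hbm⟩ := h3 m h
      have := hmin b (h1.perm.mem_iff.2 (List.mem_append_right _ hb))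
      omega
    · exact h
  cases r with
  | nil => simp at hmr
  | cons a r =>
    have ha := hmin a (h1.perm.mem_iff.2 (by simp))
    obtain rfl : m = a := by
      rcases List.mem_cons.1 hmr with h | h
      · exact h
      · have := (List.pairwise_cons.1 h2).1 m h
        omega
    exact ⟨ρ, r, h1, h2⟩

/-! ### The preorder on words generated by the weak order and Knuth equivalence -/

/-- A covering step of the right weak order on words. -/
inductive WeakStep : List ℕ → List ℕ → Prop
  | swap (α γ : List ℕ) {a b : ℕ} (hab : a < b) :
      WeakStep (α ++ a :: b :: γ) (α ++ b :: a :: γ)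

theorem KnuthStep.weakStep {u v : List ℕ} (h : KnuthStep u v) : WeakStep u v := by
  cases h with
  | @left α γ x y z hxy hyz =>
    simpa using WeakStep.swap (α ++ [y]) γ (hxy.trans hyz)
  | @right α γ x y z hxy hyz => exact WeakStep.swap α (y :: γ) (hxy.trans hyz)

theorem WeakStep.perm {u v : List ℕ} (h : WeakStep u v) : u.Perm v := by
  cases h with
  | swap α γ => exact List.Perm.append_left _ (.swap ..)

/-- A generating step of the preorder on words: a weak order step or a Knuth relation. -/
def WordStep (u v : List ℕ) : Prop := WeakStep u v ∨ KnuthStep v u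

theorem WordStep.perm {u v : List ℕ} (h : WordStep u v) : u.Perm v :=
  h.elim WeakStep.perm fun h => h.perm.symm

/-- The preorder on words generated by the weak order and Knuth equivalence. -/
abbrev WordLE : List ℕ → List ℕ → Prop := Relation.ReflTransGen WordStep

theorem KnuthEq.wordLE {u v : List ℕ} (h : KnuthEq u v) : WordLE u v ∧ WordLE v u := by
  induction h with
  | rel u v h => exact ⟨.single (.inl h.weakStep), .single (.inr h)⟩
  | refl u => exact ⟨.refl, .refl⟩
  | symm u v _ ih => exact ih.symm
  | trans u v w _ _ ih ih' => exact ⟨ih.1.trans ih'.1, ih'.2.trans ih.2⟩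

theorem WeakStep.reverse {u v : List ℕ} (h : WeakStep u v) : WeakStep v.reverse u.reverse := by
  cases h with
  | swap α γ hab => simpa using WeakStep.swap γ.reverse α.reverse hab

theorem KnuthStep.reverse {u v : List ℕ} (h : KnuthStep u v) : KnuthStep v.reverse u.reverse := by
  cases h with
  | left α γ hxy hyz => simpa using KnuthStep.right γ.reverse α.reverse hxy hyz
  | right α γ hxy hyz => simpa using KnuthStep.left γ.reverse α.reverse hxy hyz

theorem WordLE.reverse {u v : List ℕ} (h : WordLE u v) : WordLE v.reverse u.reverse := by
  induction h with
  | refl => exact .refl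
  | tail _ h ih =>
    exact .head (h.elim (fun h => .inl h.reverse) (fun h => .inr h.reverse)) ih

/-! ### The subword of letters at most `3` -/

/-- The subword of letters at most `3`. -/
def smallLetters (w : List ℕ) : List ℕ := w.filter (· ≤ 3)

theorem smallLetters_append (u v : List ℕ) :
    smallLetters (u ++ v) = smallLetters u ++ smallLetters v := List.filter_append ..

theorem smallLetters_cons_of_le {a : ℕ} (h : a ≤ 3) (w : List ℕ) :
    smallLetters (a :: w) = a :: smallLetters w := by simp [smallLetters, h]

theorem smallLetters_cons_of_lt {a : ℕ} (h : 3 < a) (w : List ℕ) :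
    smallLetters (a :: w) = smallLetters w := by simp [smallLetters, h]

theorem smallLetters_reverse (w : List ℕ) :
    smallLetters w.reverse = (smallLetters w).reverse := List.filter_reverse ..

theorem smallLetters_eq_nil {w : List ℕ} : smallLetters w = [] ↔ ∀ a ∈ w, 3 < a := by
  simp [smallLetters]

/-- The subword of letters at most `3` is in the Knuth class of `tableau13_2`. -/
def IsInner (w : List ℕ) : Prop := smallLetters w = [2, 1, 3] ∨ smallLetters w = [2, 3, 1]

theorem small_cases {w : List ℕ} (h : IsInner w ∨ smallLetters w = [3, 2, 1]) {a : ℕ}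
    (ha : a ∈ w) (h3 : a ≤ 3) : a = 1 ∨ a = 2 ∨ a = 3 := by
  have : a ∈ smallLetters w := by simp [smallLetters, ha, h3]
  rcases h with (h | h) | h <;> rw [h] at this <;> simp at this <;> omega

theorem append_eq_triple {A C : List ℕ} {a b x y z : ℕ} (h : A ++ a :: b :: C = [x, y, z]) :
    (A = [] ∧ a = x ∧ b = y ∧ C = [z]) ∨ (A = [x] ∧ a = y ∧ b = z ∧ C = []) := by
  rcases A with _ | ⟨p, _ | ⟨q, _ | ⟨r, A⟩⟩⟩ <;> simp_all

theorem append_eq_triple' {A C : List ℕ} {a b c x y z : ℕ}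
    (h : A ++ a :: b :: c :: C = [x, y, z]) : A = [] ∧ a = x ∧ b = y ∧ c = z ∧ C = [] := by
  rcases A with _ | ⟨p, _ | ⟨q, _ | ⟨r, A⟩⟩⟩ <;> simp_all

/-- The shape of a Knuth step on words whose letters at most `3` are among `1, 2, 3`. -/
theorem KnuthStep.small {u v : List ℕ} (h : KnuthStep u v)
    (hu : ∀ a ∈ u, a ≤ 3 → a = 1 ∨ a = 2 ∨ a = 3) :
    smallLetters u = smallLetters v ∨
      ∃ α γ, (u = α ++ 2 :: 1 :: 3 :: γ ∧ v = α ++ 2 :: 3 :: 1 :: γ) ∨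
        (u = α ++ 1 :: 3 :: 2 :: γ ∧ v = α ++ 3 :: 1 :: 2 :: γ) := by
  cases h with
  | @left α γ x y z hxy hyz =>
    -- Both Knuth relations exchange the extreme letters x and z. If z is large, the small subword
    -- does not change; otherwise all three letters are small, hence 1, 2, 3.
    by_cases hz : z ≤ 3
    · right
      have := hu x (by simp) (by omega)
      obtain ⟨rfl, rfl, rfl⟩ : x = 1 ∧ y = 2 ∧ z = 3 := by omega
      exact ⟨α, γ, .inl ⟨rfl, rfl⟩⟩
    · left
      simp [smallLetters, hz, List.filter_cons]
  | @right α γ x y z hxy hyz =>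
    by_cases hz : z ≤ 3
    · right
      have := hu x (by simp) (by omega)
      obtain ⟨rfl, rfl, rfl⟩ : x = 1 ∧ y = 2 ∧ z = 3 := by omega
      exact ⟨α, γ, .inr ⟨rfl, rfl⟩⟩
    · left
      simp [smallLetters, hz, List.filter_cons]

theorem KnuthStep.small_iff {u v : List ℕ} (h : KnuthStep u v) :
    (IsInner u ↔ IsInner v) ∧ (smallLetters u = [3, 2, 1] ↔ smallLetters v = [3, 2, 1]) := by
  by_cases hu : ∀ a ∈ u, a ≤ 3 → a = 1 ∨ a = 2 ∨ a = 3
  · rcases h.small hu with h | ⟨α, γ, ⟨rfl, rfl⟩ | ⟨rfl, rfl⟩⟩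
    · simp [IsInner, h]
    all_goals
      simp only [IsInner, smallLetters_append, smallLetters_cons_of_le (show 1 ≤ 3 by simp),
        smallLetters_cons_of_le (show 2 ≤ 3 by simp), smallLetters_cons_of_le (le_refl 3)]
      constructor <;> constructor <;> intro h
      on_goal 3 => exact absurd (append_eq_triple' h) (by simp)
      on_goal 3 => exact absurd (append_eq_triple' h) (by simp)
      all_goals
        rcases h with h | h <;>
        · obtain ⟨h1, h2, h3, h4, h5⟩ := append_eq_triple' h
          first
          | simp [h1, h5]; done
          | omega
  -- A word with a small letter outside 1, 2, 3 satisfies neither side of either equivalence.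
  · have hv : ¬ ∀ a ∈ v, a ≤ 3 → a = 1 ∨ a = 2 ∨ a = 3 := by
      simpa only [h.perm.mem_iff] using hu
    constructor <;> constructor <;> intro h
    · exact (hu fun a => small_cases (.inl h)).elim
    · exact (hv fun a => small_cases (.inl h)).elim
    · exact (hu fun a => small_cases (.inr h)).elim
    · exact (hv fun a => small_cases (.inr h)).elim

theorem KnuthEq.isInner_iff {u v : List ℕ} (h : KnuthEq u v) : IsInner u ↔ IsInner v := by
  induction h with
  | rel u v h => exact h.small_iff.1
  | refl u => exact .rfl
  | symm u v _ ih => exact ih.symm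
  | trans u v w _ _ ih ih' => exact ih.trans ih'

/-- The shape of a weak order step starting from a word with small letters `213`, `231`, `321`. -/
theorem WeakStep.small {u v : List ℕ} (h : WeakStep u v)
    (hu : IsInner u ∨ smallLetters u = [3, 2, 1]) :
    smallLetters u = smallLetters v ∨ (smallLetters u = [2, 1, 3] ∧ smallLetters v = [2, 3, 1] ∧
      ∃ α β γ, u = α ++ 2 :: β ++ 1 :: 3 :: γ ∧ v = α ++ 2 :: β ++ 3 :: 1 :: γ ∧
        smallLetters α = [] ∧ smallLetters β = [] ∧ smallLetters γ = []) ∨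
      (smallLetters u = [2, 3, 1] ∧ smallLetters v = [3, 2, 1]) := by
  cases h with
  | @swap α γ a b hab =>
    by_cases hb : b ≤ 3
    · have ha := hab.le.trans hb
      simp only [IsInner, smallLetters_append, smallLetters_cons_of_le ha,
        smallLetters_cons_of_le hb] at hu ⊢
      right
      -- The only adjacent ascent is 13 in 213 and 23 in 231; 321 has none.
      rcases hu with (h | h) | h
      · left
        rcases append_eq_triple h with ⟨h1, rfl, rfl, h2⟩ | ⟨h1, rfl, rfl, h2⟩
        · omega
        · have h2a : 2 ∈ α := by
            have : 2 ∈ smallLetters α := by simp [h1]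
            exact List.mem_of_mem_filter this
          obtain ⟨α, β, rfl⟩ := List.append_of_mem h2a
          rw [smallLetters_append, smallLetters_cons_of_le (by simp)] at h1
          have h3 : smallLetters α = [] ∧ smallLetters β = [] := by
            rcases h : smallLetters α with _ | ⟨c, l⟩ <;> simp_all
          refine ⟨h, ?_, α, β, γ, rfl, rfl, h3.1, h3.2, h2⟩
          rw [smallLetters_append, smallLetters_cons_of_le (by simp)]
          simp [h3, h2]
      · right
        rcases append_eq_triple h with ⟨h1, rfl, rfl, h2⟩ | ⟨h1, rfl, rfl, h2⟩
        · simp [h1, h2]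
        · omega
      · rcases append_eq_triple h with ⟨h1, rfl, rfl, h2⟩ | ⟨h1, rfl, rfl, h2⟩ <;> omega
    · left
      simp [smallLetters, hb, List.filter_cons]

theorem WordStep.isInner {u v : List ℕ} (h : WordStep u v) (hu : IsInner u) :
    IsInner v ∨ smallLetters v = [3, 2, 1] := by
  rcases h with h | h
  · rcases h.small (.inl hu) with h | h | h
    · left; rwa [IsInner, ← h]
    · exact .inl (.inr h.2.1)
    · exact .inr h.2
  · exact .inl (h.small_iff.1.2 hu)

/-- The subword 321 has no ascent and is alone in its Knuth class, so it is absorbing. This keeps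
paths between inner words among inner words. -/
theorem WordStep.small_321 {u v : List ℕ} (h : WordStep u v) (hu : smallLetters u = [3, 2, 1]) :
    smallLetters v = [3, 2, 1] := by
  rcases h with h | h
  · rcases h.small (.inr hu) with h | h | h
    · rwa [← h]
    · rw [hu] at h; simp at h
    · exact h.2
  · exact h.small_iff.2.2 hu

theorem WordLE.small_321 {u v : List ℕ} (h : WordLE u v) (hu : smallLetters u = [3, 2, 1]) :
    smallLetters v = [3, 2, 1] := by
  induction h with
  | refl => exact hu
  | tail _ h ih => exact h.small_321 ih

/-! ### The dual Knuth operation -/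

/-- The dual Knuth operation on words with inner tableau `tableau13_2`. -/
def dualKnuth (w : List ℕ) : List ℕ :=
  if smallLetters w = [2, 1, 3] then w.map (Equiv.swap 2 3) else w.map (Equiv.swap 1 2)

theorem swap_of_lt {a b x : ℕ} (ha : a ≤ 3) (hb : b ≤ 3) (hx : 3 < x) : Equiv.swap a b x = x :=
  Equiv.swap_apply_of_ne_of_ne (by omega) (by omega)

theorem swap_le_iff {a b x : ℕ} (ha : a ≤ 3) (hb : b ≤ 3) : Equiv.swap a b x ≤ 3 ↔ x ≤ 3 := by
  rw [Equiv.swap_apply_def]; split_ifs <;> omega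

theorem swap_lt_swap {a x y : ℕ} (hxy : x < y) (h : ¬ (x = a ∧ y = a + 1)) :
    Equiv.swap a (a + 1) x < Equiv.swap a (a + 1) y := by
  rw [Equiv.swap_apply_def, Equiv.swap_apply_def]; split_ifs <;> omega

theorem map_swap_of_small {a b : ℕ} (ha : a ≤ 3) (hb : b ≤ 3) {w : List ℕ}
    (h : smallLetters w = []) : w.map (Equiv.swap a b) = w := by
  rw [smallLetters_eq_nil] at h
  conv_rhs => rw [← List.map_id w]
  exact List.map_congr_left fun x hx => swap_of_lt ha hb (h x hx)

theorem smallLetters_map_swap {a b : ℕ} (ha : a ≤ 3) (hb : b ≤ 3) (w : List ℕ) :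
    smallLetters (w.map (Equiv.swap a b)) = (smallLetters w).map (Equiv.swap a b) := by
  rw [smallLetters, smallLetters, List.filter_map]
  congr 2
  funext x
  simp [swap_le_iff ha hb]

theorem dualKnuth_perm {w : List ℕ} (h : IsInner w) (hn : w.Nodup) : (dualKnuth w).Perm w := by
  have key : ∀ {a b : ℕ}, a ∈ w → b ∈ w → (w.map (Equiv.swap a b)).Perm w := by
    intro a b ha hb
    rw [List.perm_ext_iff_of_nodup (hn.map (Equiv.injective _)) hn]
    intro x
    rw [List.mem_map_of_involutive (Equiv.swap_apply_self a b), Equiv.swap_apply_def]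
    split_ifs with h1 h2 <;> simp_all
  have hm : ∀ a, a ∈ smallLetters w → a ∈ w := fun a h => List.mem_of_mem_filter h
  rcases h with h | h
  · rw [dualKnuth, if_pos h]
    exact key (hm 2 (by simp [h])) (hm 3 (by simp [h]))
  · rw [dualKnuth, if_neg (by simp [h])]
    exact key (hm 1 (by simp [h])) (hm 2 (by simp [h]))

/-- The duals 312 and 132 reverse to 213 and 231. The pattern of the original word is recovered, so
a second application uses the same exchange of values. -/
theorem dualKnuth_small {w : List ℕ} (h : IsInner w) : IsInner (dualKnuth w).reverse := by
  rcases h with h | h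
  · rw [dualKnuth, if_pos h]
    left
    rw [smallLetters_reverse, smallLetters_map_swap (by simp) (by simp), h]
    rfl
  · rw [dualKnuth, if_neg (by simp [h])]
    right
    rw [smallLetters_reverse, smallLetters_map_swap (by simp) (by simp), h]
    rfl

theorem dualKnuth_reverse_dualKnuth {w : List ℕ} (h : IsInner w) :
    (dualKnuth (dualKnuth w).reverse).reverse = w := by
  have key : ∀ a b : ℕ, (w.map (Equiv.swap a b)).map (Equiv.swap a b) = w := by
    intro a b
    rw [List.map_map]
    conv_rhs => rw [← List.map_id w]
    exact List.map_congr_left fun x _ => Equiv.swap_apply_self a b x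
  rcases h with h | h
  · have h1 : dualKnuth w = w.map (Equiv.swap 2 3) := if_pos h
    have h2 : smallLetters (dualKnuth w).reverse = [2, 1, 3] := by
      rw [h1, smallLetters_reverse, smallLetters_map_swap (by simp) (by simp), h]; rfl
    rw [dualKnuth, if_pos h2, h1, List.map_reverse, List.reverse_reverse, key]
  · have h1 : dualKnuth w = w.map (Equiv.swap 1 2) := if_neg (by simp [h])
    have h2 : smallLetters (dualKnuth w).reverse = [2, 3, 1] := by
      rw [h1, smallLetters_reverse, smallLetters_map_swap (by simp) (by simp), h]; rfl
    rw [dualKnuth, if_neg (by simp [h2]), h1, List.map_reverse, List.reverse_reverse, key]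

theorem dualKnuth_of_213 {α γ : List ℕ} (hα : smallLetters α = []) (hγ : smallLetters γ = [])
    (b : List ℕ) (hb : smallLetters b = []) :
    dualKnuth (α ++ 2 :: (b ++ 1 :: 3 :: γ)) = α ++ 3 :: (b ++ 1 :: 2 :: γ) := by
  rw [dualKnuth, if_pos]
  · have e1 : Equiv.swap 2 3 1 = 1 := rfl
    simp [map_swap_of_small, hα, hγ, hb, e1]
  · simp [smallLetters_append, smallLetters_cons_of_le, hα, hγ, hb]

theorem dualKnuth_of_231 {α γ : List ℕ} (hα : smallLetters α = []) (hγ : smallLetters γ = []) :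
    dualKnuth (α ++ 2 :: 3 :: 1 :: γ) = α ++ 1 :: 3 :: 2 :: γ := by
  rw [dualKnuth, if_neg]
  · have e1 : Equiv.swap 1 2 3 = 3 := rfl
    simp [map_swap_of_small, hα, hγ, e1]
  · simp [smallLetters_append, smallLetters_cons_of_le, hα, hγ]

/-- The exchanged values, 2 and 3 in 213 or 1 and 2 in 231, are separated by the third small letter.
So the exchange never affects the relative order of two small letters that are neighbours in the
subword. -/
theorem dualKnuth_congr {u v : List ℕ} (h : IsInner u) (huv : smallLetters u = smallLetters v) :
    ∃ a, a + 1 ≤ 3 ∧ dualKnuth u = u.map (Equiv.swap a (a + 1)) ∧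
      dualKnuth v = v.map (Equiv.swap a (a + 1)) ∧
      (∀ A C, smallLetters u ≠ A ++ a :: (a + 1) :: C) ∧
      ∀ A C, smallLetters u ≠ A ++ (a + 1) :: a :: C := by
  rcases h with h | h
  · refine ⟨2, le_rfl, if_pos h, if_pos (huv ▸ h), fun A C e => ?_, fun A C e => ?_⟩ <;>
    · rw [h] at e
      have := append_eq_triple e.symm
      omega
  · refine ⟨1, by simp, if_neg (by simp [h]), if_neg (by simp [← huv, h]),
      fun A C e => ?_, fun A C e => ?_⟩ <;>
    · rw [h] at e
      have := append_eq_triple e.symm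
      omega

theorem KnuthStep.dualKnuth {u v : List ℕ} (h : KnuthStep u v) (hu : IsInner u) :
    KnuthEq (dualKnuth u) (dualKnuth v) := by
  have hv := h.small_iff.1.1 hu
  rcases h.small fun a => small_cases (.inl hu) with he | ⟨α, γ, ⟨rfl, rfl⟩ | ⟨rfl, rfl⟩⟩
  · obtain ⟨a, ha, e1, e2, n1, n2⟩ := dualKnuth_congr hu he
    rw [e1, e2]
    refine .rel _ _ ?_
    cases h with
    | @left α γ x y z hxy hyz =>
      -- Here z ≤ 3 would make all three letters small, and the step would alter the small subword.
      have h1 : ¬ (y = a ∧ z = a + 1) := by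
        rintro ⟨rfl, rfl⟩
        have hx : x ≤ 3 := by omega
        have hz : y ≤ 3 := by omega
        simp [smallLetters, hx, ha, hz] at he
        omega
      have h2 : ¬ (x = a ∧ y = a + 1) := by
        rintro ⟨rfl, rfl⟩
        by_cases hz : z ≤ 3
        · simp [smallLetters, ha, hz, (show x ≤ 3 by omega)] at he
          omega
        -- With z large, y and x would be neighbours in the small subword.
        · refine n2 (smallLetters α) (smallLetters γ) ?_
          rw [smallLetters_append, smallLetters_cons_of_le ha, smallLetters_cons_of_le (by omega),
            smallLetters_cons_of_lt (by omega)]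
      simpa using KnuthStep.left (α.map (Equiv.swap a (a + 1))) (γ.map (Equiv.swap a (a + 1)))
        (swap_lt_swap hxy h2) (swap_lt_swap hyz h1)
    | @right α γ x y z hxy hyz =>
      have h1 : ¬ (y = a ∧ z = a + 1) := by
        rintro ⟨rfl, rfl⟩
        have hx : x ≤ 3 := by omega
        have hz : y ≤ 3 := by omega
        simp [smallLetters, hx, ha, hz] at he
        omega
      have h2 : ¬ (x = a ∧ y = a + 1) := by
        rintro ⟨rfl, rfl⟩
        by_cases hz : z ≤ 3
        · simp [smallLetters, ha, hz, (show x ≤ 3 by omega)] at he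
          omega
        · refine n1 (smallLetters α) (smallLetters γ) ?_
          rw [smallLetters_append, smallLetters_cons_of_le (by omega),
            smallLetters_cons_of_lt (by omega), smallLetters_cons_of_le ha]
      simpa using KnuthStep.right (α.map (Equiv.swap a (a + 1))) (γ.map (Equiv.swap a (a + 1)))
        (swap_lt_swap hxy h2) (swap_lt_swap hyz h1)
  · have h1 : smallLetters α = [] ∧ smallLetters γ = [] := by
      simp only [IsInner, smallLetters_append, smallLetters_cons_of_le (show 1 ≤ 3 by simp),
        smallLetters_cons_of_le (show 2 ≤ 3 by simp), smallLetters_cons_of_le (le_refl 3)] at hu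
      rcases hu with h | h <;>
      · obtain ⟨h1, -, -, -, h2⟩ := append_eq_triple' h
        exact ⟨h1, h2⟩
    have e := dualKnuth_of_213 h1.1 h1.2 [] rfl
    rw [List.nil_append, List.nil_append] at e
    rw [e, dualKnuth_of_231 h1.1 h1.2]
    -- The move 213 → 231 becomes 312 ← 132: the orientation flips, which is harmless for an
    -- equivalence.
    exact KnuthEq.symm (.rel _ _ (.right α γ (by simp) (by simp)))
  · exfalso
    simp only [IsInner, smallLetters_append, smallLetters_cons_of_le (show 1 ≤ 3 by simp),
      smallLetters_cons_of_le (show 2 ≤ 3 by simp), smallLetters_cons_of_le (le_refl 3)] at hu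
    rcases hu with h | h <;> simpa using (append_eq_triple' h).2.1

theorem KnuthEq.dualKnuth {u v : List ℕ} (h : KnuthEq u v) (hu : IsInner u) :
    KnuthEq (dualKnuth u) (dualKnuth v) := by
  induction h with
  | rel u v h => exact h.dualKnuth hu
  | refl u => exact .refl _
  | symm u v h ih => exact (ih ((KnuthEq.isInner_iff h).2 hu)).symm
  | trans u v w h _ ih ih' => exact (ih hu).trans (ih' ((KnuthEq.isInner_iff h).1 hu))

/-- The chain is 2br13 ~ 2b1r3 ~ 21br3 ~ 21b3r ~ 2b13r. The detour through 21b puts b next to r,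
where it serves as the witness for moving 3 left. -/
theorem knuthEq_213_big {b : ℕ} {r : List ℕ} (hb : 3 < b) (hr : (b :: r).Pairwise (· < ·)) :
    KnuthEq (2 :: b :: (r ++ [1, 3])) (2 :: b :: 1 :: 3 :: r) := by
  have h1 : KnuthEq (2 :: b :: (r ++ [1, 3])) (2 :: b :: 1 :: (r ++ [3])) := by
    simpa using ((knuthEq_move_left (x := 1) (by omega) hr).append_right [3]).cons 2
  have h2 : KnuthEq (2 :: b :: 1 :: (r ++ [3])) (2 :: 1 :: b :: (r ++ [3])) :=
    KnuthEq.symm (.rel _ _ (.left [] _ (by simp) (by omega)))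
  have h3 : KnuthEq (2 :: 1 :: b :: (r ++ [3])) (2 :: 1 :: b :: 3 :: r) :=
    ((knuthEq_move_left hb hr).cons 1).cons 2
  have h4 : KnuthEq (2 :: 1 :: b :: 3 :: r) (2 :: b :: 1 :: 3 :: r) :=
    .rel _ _ (.right [2] _ (by simp) hb)
  exact ((h1.trans h2).trans h3).trans h4

/-- The chain is 2br31 ~ 2b3r1 ~ b23r1 ~ b231r ~ b213r. The result differs from that of
`knuthEq_213_big` only in the order of 2 and b. -/
theorem knuthEq_231_big {b : ℕ} {r : List ℕ} (hb : 3 < b) (hr : (b :: r).Pairwise (· < ·)) :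
    KnuthEq (2 :: b :: (r ++ [3, 1])) (b :: 2 :: 1 :: 3 :: r) := by
  have h1 : KnuthEq (2 :: b :: (r ++ [3, 1])) (2 :: b :: 3 :: (r ++ [1])) := by
    simpa using ((knuthEq_move_left (x := 3) hb hr).append_right [1]).cons 2
  have h2 : KnuthEq (2 :: b :: 3 :: (r ++ [1])) (b :: 2 :: 3 :: (r ++ [1])) :=
    .rel _ _ (.right [] _ (by simp) hb)
  have hr' : (3 :: r).Pairwise (· < ·) := by
    rw [List.pairwise_cons] at hr ⊢
    exact ⟨fun a ha => hb.trans (hr.1 a ha), hr.2⟩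
  have h3 : KnuthEq (b :: 2 :: 3 :: (r ++ [1])) (b :: 2 :: 3 :: 1 :: r) :=
    ((knuthEq_move_left (by simp) hr').cons 2).cons b
  have h4 : KnuthEq (b :: 2 :: 3 :: 1 :: r) (b :: 2 :: 1 :: 3 :: r) :=
    KnuthEq.symm (.rel _ _ (.left [b] _ (by simp) (by simp)))
  exact ((h1.trans h2).trans h3).trans h4

/-- The heart of the argument: the literal duals α3β12γ and α1β32γ disagree on which of 1 and 3
comes first, so better Knuth representatives must be chosen before dualizing. -/
theorem dualKnuth_wordLE_of_swap {α β γ : List ℕ} (hα : smallLetters α = [])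
    (hβ : smallLetters β = []) (hγ : smallLetters γ = [])
    (hn : (α ++ 2 :: β ++ 1 :: 3 :: γ).Nodup) :
    WordLE (dualKnuth (α ++ 2 :: β ++ 1 :: 3 :: γ)) (dualKnuth (α ++ 2 :: β ++ 3 :: 1 :: γ)) := by
  have hα' := smallLetters_eq_nil.1 hα
  have hβ' := smallLetters_eq_nil.1 hβ
  have hu : IsInner (α ++ 2 :: β ++ 1 :: 3 :: γ) := by
    left; simp [smallLetters_append, smallLetters_cons_of_le, hα, hβ, hγ]
  have hv : IsInner (α ++ 2 :: β ++ 3 :: 1 :: γ) := by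
    right; simp [smallLetters_append, smallLetters_cons_of_le, hα, hβ, hγ]
  -- The prefix α2β contains no small letter but 2, so 2 is its minimum and heads the increasing
  -- run.
  obtain ⟨ρ, r, h1, hr⟩ := exists_knuthEq_append_sorted hn.of_append_left (m := 2) (by simp) (by
    intro a ha
    simp only [List.mem_append, List.mem_cons] at ha
    rcases ha with ha | rfl | ha
    · have := hα' a ha; omega
    · exact le_rfl
    · have := hβ' a ha; omega)
  have hs : smallLetters ρ = [] ∧ smallLetters r = [] := by
    have := (h1.perm.filter (fun x => decide (x ≤ 3))).length_eq
    change (smallLetters _).length = (smallLetters _).length at this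
    simp only [smallLetters_append, smallLetters_cons_of_le (show 2 ≤ 3 by simp), hα, hβ,
      List.length_append, List.length_cons, List.length_nil] at this
    constructor <;> apply List.length_eq_zero_iff.1 <;> omega
  have hu1 := h1.append_right (1 :: 3 :: γ)
  have hv1 := h1.append_right (3 :: 1 :: γ)
  cases r with
  | nil =>
    refine (KnuthEq.dualKnuth (hu1.trans (.trans ?_ hv1.symm)) hu).wordLE.1
    simpa using Relation.EqvGen.rel _ _ (KnuthStep.left ρ γ (show 1 < 2 by simp) (by simp))
  | cons b r =>
    rw [List.pairwise_cons] at hr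
    have hb3 : 3 < b := smallLetters_eq_nil.1 hs.2 b (by simp)
    have hsr : smallLetters r = [] := by
      rw [← smallLetters_cons_of_lt hb3]; exact hs.2
    have hrγ : smallLetters (r ++ γ) = [] := by simp [smallLetters_append, hsr, hγ]
    have hu2 : KnuthEq (α ++ 2 :: β ++ 1 :: 3 :: γ) (ρ ++ 2 :: ([b] ++ 1 :: 3 :: (r ++ γ))) :=
      hu1.trans (by simpa using (knuthEq_213_big hb3 hr.2).append ρ γ)
    have hv2 : KnuthEq (α ++ 2 :: β ++ 3 :: 1 :: γ)
        ((ρ ++ [b]) ++ 2 :: ([] ++ 1 :: 3 :: (r ++ γ))) :=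
      hv1.trans (by simpa using (knuthEq_231_big hb3 hr.2).append ρ γ)
    have hu3 := hu2.dualKnuth hu
    have hv3 := hv2.dualKnuth hv
    have hsb : smallLetters [b] = [] := by rw [smallLetters_cons_of_lt hb3]; rfl
    rw [dualKnuth_of_213 hs.1 hrγ [b] hsb] at hu3
    rw [dualKnuth_of_213 (by simp [smallLetters_append, hs.1, hsb]) hrγ [] rfl] at hv3
    -- Both representatives have pattern 213, so both duals exchange 2 and 3, giving ρ3b12… and
    -- ρb312….
    refine hu3.wordLE.1.trans (.trans (.single (.inl ?_)) hv3.wordLE.2)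
    simpa using WeakStep.swap ρ (1 :: 2 :: (r ++ γ)) hb3

theorem WordStep.dualKnuth {u v : List ℕ} (h : WordStep u v) (hu : IsInner u) (hv : IsInner v)
    (hn : u.Nodup) : WordLE (dualKnuth u) (dualKnuth v) := by
  rcases h with h | h
  · rcases h.small (.inl hu) with he | ⟨-, -, α, β, γ, rfl, rfl, hα, hβ, hγ⟩ | ⟨-, he⟩
    · obtain ⟨a, ha, e1, e2, n1, n2⟩ := dualKnuth_congr hu he
      rw [e1, e2]
      refine .single (.inl ?_)
      cases h with
      | @swap α γ x y hxy =>
        have h1 : ¬ (x = a ∧ y = a + 1) := by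
          rintro ⟨rfl, rfl⟩
          refine n1 (smallLetters α) (smallLetters γ) ?_
          rw [smallLetters_append, smallLetters_cons_of_le (by omega), smallLetters_cons_of_le ha]
        simpa using WeakStep.swap (α.map (Equiv.swap a (a + 1))) (γ.map (Equiv.swap a (a + 1)))
          (swap_lt_swap hxy h1)
    · exact dualKnuth_wordLE_of_swap hα hβ hγ hn
    · rcases hv with h | h <;> simp [he] at h
  · exact (h.dualKnuth hv).wordLE.2

theorem WordLE.dualKnuth {u v : List ℕ} (h : WordLE u v) (hu : IsInner u) (hv : IsInner v)
    (hn : u.Nodup) : WordLE (dualKnuth u) (dualKnuth v) := by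
  induction h using Relation.ReflTransGen.head_induction_on with
  | refl => exact .refl
  | head h h' ih =>
    rcases h.isInner hu with hw | hw
    · exact (h.dualKnuth hu hw hn).trans (ih hw (h.perm.nodup_iff.1 hn))
    · have := WordLE.small_321 h' hw
      rcases hv with h | h <;> simp [this] at h

/-- Reflection is preservation applied to the reversed duals, which are again inner; the involution
then returns the original words. -/
theorem wordLE_dualKnuth_iff {u v : List ℕ} (hu : IsInner u) (hv : IsInner v) (hnu : u.Nodup)
    (hnv : v.Nodup) : WordLE (dualKnuth u) (dualKnuth v) ↔ WordLE u v := by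
  refine ⟨fun h => ?_, fun h => h.dualKnuth hu hv hnu⟩
  have h1 := (WordLE.reverse h).dualKnuth (dualKnuth_small hv) (dualKnuth_small hu)
    (List.nodup_reverse.2 ((dualKnuth_perm hv hnv).nodup_iff.2 hnv))
  have h2 := WordLE.reverse h1
  rwa [dualKnuth_reverse_dualKnuth hu, dualKnuth_reverse_dualKnuth hv] at h2

/-! ### Permutations as words -/

theorem length_permWord {n : ℕ} (u : Equiv.Perm (Fin n)) : (permWord u).length = n := by
  simp [permWord]

theorem getElem_permWord {n : ℕ} (u : Equiv.Perm (Fin n)) {i : ℕ} (h : i < (permWord u).length) :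
    (permWord u)[i] = (u ⟨i, by simpa [length_permWord] using h⟩ : ℕ) + 1 := by
  simp [permWord]

theorem permWord_nodup {n : ℕ} (u : Equiv.Perm (Fin n)) : (permWord u).Nodup := by
  refine List.nodup_ofFn.2 fun i j h => ?_
  have h : (u i : ℕ) + 1 = u j + 1 := h
  exact u.injective (Fin.ext (by omega))

theorem permWord_injective {n : ℕ} : Function.Injective (permWord (n := n)) := by
  intro u v h
  have h := List.ofFn_injective h
  ext i
  have := congrFun h i
  simpa using this

theorem permWord_perm {n : ℕ} (u : Equiv.Perm (Fin n)) : (permWord u).Perm (List.range' 1 n) := by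
  rw [List.perm_ext_iff_of_nodup (permWord_nodup u) List.nodup_range']
  intro a
  simp only [permWord, List.mem_ofFn, List.mem_range'_1]
  constructor
  · rintro ⟨i, rfl⟩
    have := (u i).isLt
    omega
  · intro h
    refine ⟨u.symm ⟨a - 1, by omega⟩, ?_⟩
    simp
    omega

theorem exists_permWord_eq {n : ℕ} {l : List ℕ} (h : l.Perm (List.range' 1 n)) :
    ∃ u : Equiv.Perm (Fin n), permWord u = l := by
  have hl : l.length = n := by simpa using h.length_eq
  have hmem : ∀ a ∈ l, 1 ≤ a ∧ a < 1 + n := fun a ha => List.mem_range'_1.1 (h.mem_iff.1 ha)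
  have hn : l.Nodup := h.nodup_iff.2 List.nodup_range'
  let f : Fin n → Fin n := fun i => ⟨l[(i : ℕ)]'(hl.symm ▸ i.isLt) - 1, by
    have := hmem _ (List.getElem_mem (hl.symm ▸ i.isLt : (i : ℕ) < l.length))
    omega⟩
  have hf : Function.Injective f := by
    intro i j hij
    have hi := hmem _ (List.getElem_mem (hl.symm ▸ i.isLt : (i : ℕ) < l.length))
    have hj := hmem _ (List.getElem_mem (hl.symm ▸ j.isLt : (j : ℕ) < l.length))
    have hij := congrArg Fin.val hij
    dsimp only [f] at hij
    exact Fin.ext ((hn.getElem_inj_iff).1 (by omega))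
  refine ⟨Equiv.ofBijective f (Finite.injective_iff_bijective.1 hf), ?_⟩
  refine List.ext_getElem (by rw [length_permWord, hl]) fun i h1 h2 => ?_
  rw [getElem_permWord]
  have := hmem _ (List.getElem_mem h2)
  simp only [Equiv.ofBijective_apply, f]
  omega

/-- Multiplying by an adjacent transposition on the right swaps two adjacent letters. -/
theorem permWord_mul_swap {n : ℕ} (u : Equiv.Perm (Fin n)) {i : ℕ} (h : i + 1 < n) :
    ∃ α γ a b, α.length = i ∧ permWord u = α ++ a :: b :: γ ∧
      permWord (u * Equiv.swap ⟨i, Nat.lt_of_succ_lt h⟩ ⟨i + 1, h⟩) = α ++ b :: a :: γ := by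
  have hl := length_permWord u
  refine ⟨(permWord u).take i, (permWord u).drop (i + 2), (permWord u)[i], (permWord u)[i + 1],
    by rw [List.length_take]; omega, by simp, ?_⟩
  refine List.ext_getElem (by simp [length_permWord]; omega) fun j h1 h2 => ?_
  rw [length_permWord] at h1
  simp only [getElem_permWord, Equiv.Perm.coe_mul, Function.comp_apply, List.getElem_append,
    List.length_take, hl, List.getElem_take, List.getElem_cons, List.getElem_drop]
  have hmin : min i n = i := by omega
  simp only [hmin]
  rcases lt_trichotomy j i with hj | rfl | hj
  · rw [Equiv.swap_apply_of_ne_of_ne (by simp; omega) (by simp; omega)]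
    simp [hj]
  · simp
  · rcases eq_or_ne j (i + 1) with rfl | hj'
    · simp
    · rw [Equiv.swap_apply_of_ne_of_ne (by simp; omega) (by simp; omega)]
      have e1 : ¬ j < i := by omega
      have e2 : ¬ j - i = 0 := by omega
      have e3 : ¬ j - i - 1 = 0 := by omega
      have e4 : i + 2 + (j - i - 1 - 1) = j := by omega
      simp [e1, e2, e3, e4]

theorem exists_adjTransposition {n : ℕ} {u : Equiv.Perm (Fin n)} {α γ : List ℕ} {a b : ℕ}
    (h : permWord u = α ++ a :: b :: γ) :
    ∃ s, IsAdjTransposition s ∧ permWord (u * s) = α ++ b :: a :: γ := by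
  have hl : α.length + 1 < n := by
    have := length_permWord u
    rw [h] at this
    simp at this
    omega
  obtain ⟨α', γ', a', b', h1, h2, h3⟩ := permWord_mul_swap u hl
  refine ⟨_, ⟨α.length, hl, rfl⟩, ?_⟩
  rw [h] at h2
  obtain ⟨rfl, h4⟩ := List.append_inj h2 h1.symm
  simp only [List.cons.injEq] at h4
  obtain ⟨rfl, rfl, rfl⟩ := h4
  exact h3

/-! ### Length and inversions -/

/-- The number of inversions of a word. -/
def inversionNumber : List ℕ → ℕ
  | [] => 0
  | a :: l => l.countP (· < a) + inversionNumber l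

theorem WeakStep.inversionNumber {u v : List ℕ} (h : WeakStep u v) :
    inversionNumber v = inversionNumber u + 1 := by
  cases h with
  | @swap α γ a b hab =>
    induction α with
    | nil =>
      simp [_root_.inversionNumber, hab, hab.not_gt]
      omega
    | cons c α ih =>
      have : (α ++ b :: a :: γ).countP (· < c) = (α ++ a :: b :: γ).countP (· < c) :=
        (List.Perm.append_left _ (.swap ..)).countP_eq _
      simp only [List.cons_append, _root_.inversionNumber, ih, this]
      omega

theorem sorted_or_descent (l : List ℕ) : l.Pairwise (· ≤ ·) ∨ ∃ v, WeakStep v l := by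
  induction l with
  | nil => simp
  | cons a l ih =>
    rcases ih with h | ⟨v, h⟩
    · cases l with
      | nil => simp
      | cons b l =>
        rcases le_or_gt a b with hab | hab
        · left
          rw [List.pairwise_cons]
          refine ⟨fun c hc => ?_, h⟩
          rcases List.mem_cons.1 hc with rfl | hc
          · exact hab
          · exact hab.trans ((List.pairwise_cons.1 h).1 c hc)
        · exact .inr ⟨_, .swap [] l hab⟩
    · right
      cases h with
      | swap α γ hab => exact ⟨_, .swap (a :: α) γ hab⟩

theorem WeakStep.exists_mul {n : ℕ} {u : Equiv.Perm (Fin n)} {v : List ℕ}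
    (h : WeakStep (permWord u) v ∨ WeakStep v (permWord u)) :
    ∃ s, IsAdjTransposition s ∧ permWord (u * s) = v := by
  rcases h with h | h
  · generalize hu : permWord u = l at h
    cases h with
    | swap α γ hab => exact exists_adjTransposition hu
  · generalize hu : permWord u = l at h
    cases h with
    | swap α γ hab => exact exists_adjTransposition hu

theorem IsAdjTransposition.weakStep {n : ℕ} {s : Equiv.Perm (Fin n)} (hs : IsAdjTransposition s)
    (u : Equiv.Perm (Fin n)) :
    WeakStep (permWord u) (permWord (u * s)) ∨ WeakStep (permWord (u * s)) (permWord u) := by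
  obtain ⟨i, h, rfl⟩ := hs
  obtain ⟨α, γ, a, b, -, h1, h2⟩ := permWord_mul_swap u h
  rw [h1, h2]
  rcases lt_trichotomy a b with hab | rfl | hab
  · exact .inl (.swap α γ hab)
  · have := permWord_nodup u
    rw [h1] at this
    simp [List.nodup_append] at this
  · exact .inr (.swap α γ hab)

theorem inversionNumber_permWord_prod_le {n : ℕ} (l : List (Equiv.Perm (Fin n)))
    (hl : ∀ s ∈ l, IsAdjTransposition s) : inversionNumber (permWord l.prod) ≤ l.length := by
  induction l using List.reverseRecOn with
  | nil =>
    have h0 : ∀ w : List ℕ, w.Pairwise (· ≤ ·) → inversionNumber w = 0 := by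
      intro w
      induction w with
      | nil => simp [inversionNumber]
      | cons a w ih =>
        intro h
        rw [List.pairwise_cons] at h
        rw [inversionNumber, ih h.2, List.countP_eq_zero.2 (by simpa using h.1)]
    rw [h0]
    · simp
    · rw [permWord, List.pairwise_ofFn]
      intro i j hij
      have : (i : ℕ) < j := hij
      simp
      omega
  | append_singleton l s ih =>
    have h1 := ih fun s hs => hl s (by simp [hs])
    rw [List.prod_append, List.prod_singleton, List.length_append, List.length_singleton]
    rcases (hl s (by simp)).weakStep l.prod with h | h <;> have := h.inversionNumber <;> omega

/-- Removing an adjacent descent lowers the inversion number by one, and a word without descents is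
the identity. -/
theorem exists_reducedWord {n : ℕ} (u : Equiv.Perm (Fin n)) :
    ∃ l : List (Equiv.Perm (Fin n)), (∀ s ∈ l, IsAdjTransposition s) ∧ l.prod = u ∧
      l.length = inversionNumber (permWord u) := by
  induction hk : inversionNumber (permWord u) using Nat.strong_induction_on generalizing u with
  | _ k ih =>
    rcases sorted_or_descent (permWord u) with h | ⟨v, h⟩
    · have h1 : permWord u = permWord (1 : Equiv.Perm (Fin n)) := by
        refine List.Perm.eq_of_pairwise (le := (· ≤ ·)) (fun a b _ _ => le_antisymm) h ?_
          ((permWord_perm u).trans (permWord_perm 1).symm)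
        rw [permWord, List.pairwise_ofFn]
        intro i j hij
        have : (i : ℕ) < j := hij
        simp
        omega
      obtain rfl := permWord_injective h1
      refine ⟨[], by simp, by simp, ?_⟩
      have := inversionNumber_permWord_prod_le ([] : List (Equiv.Perm (Fin n))) (by simp)
      simp only [List.prod_nil, List.length_nil] at this ⊢
      omega
    · obtain ⟨s, hs, rfl⟩ := WeakStep.exists_mul (.inr h)
      have h2 := h.inversionNumber
      obtain ⟨l, h3, h4, h5⟩ := ih _ (by omega) (u * s) rfl
      refine ⟨l ++ [s], ?_, ?_, ?_⟩
      · intro t ht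
        rcases List.mem_append.1 ht with ht | ht
        · exact h3 t ht
        · rw [List.mem_singleton.1 ht]; exact hs
      · obtain ⟨i, hi, rfl⟩ := hs
        rw [List.prod_append, h4, List.prod_singleton, mul_assoc, Equiv.swap_mul_self, mul_one]
      · rw [List.length_append, List.length_singleton, h5]
        omega

theorem permLength_eq {n : ℕ} (u : Equiv.Perm (Fin n)) :
    permLength u = inversionNumber (permWord u) := by
  refine le_antisymm (Nat.sInf_le (exists_reducedWord u)) (le_csInf ⟨_, exists_reducedWord u⟩ ?_)
  rintro m ⟨l, h1, rfl, rfl⟩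
  exact inversionNumber_permWord_prod_le l h1

theorem PermWeakLE.wordLE {n : ℕ} {u v : Equiv.Perm (Fin n)} (h : PermWeakLE u v) :
    WordLE (permWord u) (permWord v) := by
  induction h with
  | refl => exact .refl
  | @tail v w _ h ih =>
    obtain ⟨s, hs, rfl, h⟩ := h
    refine ih.tail (.inl ?_)
    rcases hs.weakStep v with h' | h'
    · exact h'
    · have := h'.inversionNumber
      rw [permLength_eq, permLength_eq] at h
      omega

theorem WeakStep.permWeakLE {n : ℕ} {u v : Equiv.Perm (Fin n)}
    (h : WeakStep (permWord u) (permWord v)) : PermWeakLE u v := by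
  obtain ⟨s, hs, e⟩ := WeakStep.exists_mul (.inl h)
  refine .single ⟨s, hs, (permWord_injective e).symm, ?_⟩
  rw [permLength_eq, permLength_eq, h.inversionNumber]

/-! ### Standard tableaux as lists of rows -/

/-- Since the default never occurs in the lists, their lengths can be read off from the values. This
is applied to entries with default 0 and to rows with default `[]`. -/
theorem eq_of_getD_eq {α : Type*} {d : α} {l l' : List α} (hl : d ∉ l) (hl' : d ∉ l')
    (h : ∀ i, l.getD i d = l'.getD i d) : l = l' := by
  have key : ∀ {l : List α}, d ∉ l → ∀ i, i < l.length ↔ l.getD i d ≠ d := by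
    intro l hl i
    by_cases hi : i < l.length
    · simp only [hi, true_iff, List.getD_eq_getElem _ _ hi]
      exact fun e => hl (e ▸ List.getElem_mem hi)
    · simp [hi]
  have hlt : ∀ i, i < l.length ↔ i < l'.length := fun i => by rw [key hl, key hl', h]
  have hlen : l.length = l'.length :=
    le_antisymm (not_lt.1 fun e => lt_irrefl _ ((hlt _).1 e))
      (not_lt.1 fun e => lt_irrefl _ ((hlt _).2 e))
  refine List.ext_getElem hlen fun i h1 h2 => ?_
  rw [← List.getD_eq_getElem _ d h1, ← List.getD_eq_getElem _ d h2, h]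

theorem eq_of_rowsEntry_eq {t t' : List (List ℕ)} (hn : [] ∉ t) (hn' : [] ∉ t')
    (h0 : ∀ r ∈ t, 0 ∉ r) (h0' : ∀ r ∈ t', 0 ∉ r)
    (h : ∀ i j, rowsEntry t i j = rowsEntry t' i j) : t = t' := by
  have key : ∀ {t : List (List ℕ)}, (∀ r ∈ t, 0 ∉ r) → ∀ i, 0 ∉ t.getD i [] := by
    intro t ht i
    by_cases hi : i < t.length
    · rw [List.getD_eq_getElem _ _ hi]
      exact ht _ (List.getElem_mem hi)
    · simp [hi]
  exact eq_of_getD_eq hn hn' fun i => eq_of_getD_eq (key h0 i) (key h0' i) (h i)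

theorem IsTableau.nil_notMem {t : List (List ℕ)} (h : IsTableau t) : [] ∉ t := by
  induction t with
  | nil => simp
  | cons r rs ih => simp [ih h.2.2.2, h.1.symm]

theorem RowAbove.trans {a b c : List ℕ} (h : RowAbove a b) (h' : RowAbove b c) :
    RowAbove a c := by
  induction c generalizing a b with
  | nil => cases a <;> simp [RowAbove]
  | cons z c ih =>
    cases b with
    | nil => exact h'.elim
    | cons y b =>
      cases a with
      | nil => exact h.elim
      | cons x a => exact ⟨h.1.trans h'.1, ih h.2 h'.2⟩

theorem RowAbove.length_le {a b : List ℕ} (h : RowAbove a b) : b.length ≤ a.length := by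
  induction b generalizing a with
  | nil => simp
  | cons y b ih =>
    cases a with
    | nil => exact h.elim
    | cons x a => simpa using ih h.2

theorem RowAbove.getD_lt {a b : List ℕ} (h : RowAbove a b) {j : ℕ} (hj : j < b.length) :
    a.getD j 0 < b.getD j 0 := by
  induction b generalizing a j with
  | nil => simp at hj
  | cons y b ih =>
    cases a with
    | nil => exact h.elim
    | cons x a =>
      cases j with
      | zero => exact h.1
      | succ j => simpa using ih h.2 (by simpa using hj)

theorem IsTableau.pairwise_rowAbove {t : List (List ℕ)} (h : IsTableau t) :
    t.Pairwise RowAbove := by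
  induction t with
  | nil => simp
  | cons r rs ih =>
    rw [List.pairwise_cons]
    refine ⟨?_, ih h.2.2.2⟩
    cases rs with
    | nil => simp
    | cons s ss =>
      have hs := h.2.2.1 s (by simp)
      intro r' hr'
      rcases List.mem_cons.1 hr' with rfl | hr'
      · exact hs
      · exact hs.trans ((List.pairwise_cons.1 (ih h.2.2.2)).1 r' hr')

theorem rowAbove_map_range {p q : ℕ} {f g : ℕ → ℕ} (hqp : q ≤ p) (h : ∀ j < q, f j < g j) :
    RowAbove ((List.range p).map f) ((List.range q).map g) := by
  induction q generalizing p f g with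
  | zero => simp [RowAbove]
  | succ q ih =>
    obtain ⟨p, rfl⟩ : ∃ p', p = p' + 1 := ⟨p - 1, by omega⟩
    rw [List.range_succ_eq_map, List.range_succ_eq_map, List.map_cons, List.map_cons, List.map_map,
      List.map_map]
    exact ⟨h 0 (by omega), ih (by omega) fun j hj => h (j + 1) (by omega)⟩

theorem isTableau_map_range {k : ℕ} {f : ℕ → List ℕ} (h1 : ∀ i < k, f i ≠ [])
    (h2 : ∀ i < k, (f i).Pairwise (· ≤ ·)) (h3 : ∀ i, i + 1 < k → RowAbove (f i) (f (i + 1))) :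
    IsTableau ((List.range k).map f) := by
  induction k generalizing f with
  | zero => trivial
  | succ k ih =>
    rw [List.range_succ_eq_map, List.map_cons, List.map_map]
    refine ⟨h1 0 (by omega), h2 0 (by omega), ?_, ih (fun i hi => h1 (i + 1) (by omega))
      (fun i hi => h2 (i + 1) (by omega)) fun i hi => h3 (i + 1) (by omega)⟩
    cases k with
    | zero => simp
    | succ k =>
      intro r hr
      rw [List.range_succ_eq_map] at hr
      obtain rfl : f 1 = r := by simpa using hr
      exact h3 0 (by omega)

namespace StdYoungTableau

variable {n : ℕ}

/-- The rows of a standard Young tableau, from top to bottom. -/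
def rowsList (T : StdYoungTableau n) : List (List ℕ) :=
  (List.range (T.shape.colLen 0)).map fun i => (List.range (T.shape.rowLen i)).map (T.entry i)

theorem lt_colLen_iff (T : StdYoungTableau n) {i : ℕ} :
    i < T.shape.colLen 0 ↔ 0 < T.shape.rowLen i := by
  rw [← YoungDiagram.mem_iff_lt_colLen, YoungDiagram.mem_iff_lt_rowLen]

theorem rowsEntry_rowsList (T : StdYoungTableau n) (i j : ℕ) :
    rowsEntry T.rowsList i j = T.entry i j := by
  unfold rowsEntry rowsList
  by_cases hij : (i, j) ∈ T.shape
  · have hj := YoungDiagram.mem_iff_lt_rowLen.1 hij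
    have hi := T.lt_colLen_iff.2 (Nat.zero_lt_of_lt hj)
    simp [List.getD, hi, hj]
  · rw [T.zeros hij]
    have hj : ¬ j < T.shape.rowLen i := fun h => hij (YoungDiagram.mem_iff_lt_rowLen.2 h)
    by_cases hi : i < T.shape.colLen 0 <;> simp [List.getD, hi, hj]

theorem isTableau_rowsList (T : StdYoungTableau n) : IsTableau T.rowsList := by
  refine isTableau_map_range (fun i hi => ?_) (fun i hi => ?_) fun i hi => ?_
  · have := T.lt_colLen_iff.1 hi
    simp
    omega
  · rw [List.pairwise_map]
    refine List.pairwise_lt_range.imp_of_mem fun {a b} _ hb hab => ?_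
    exact (T.row_strict hab (YoungDiagram.mem_iff_lt_rowLen.2 (List.mem_range.1 hb))).le
  · exact rowAbove_map_range (T.shape.rowLen_anti _ _ (by omega)) fun j hj =>
      T.col_strict (by omega) (YoungDiagram.mem_iff_lt_rowLen.2 hj)

theorem mem_flatten_rowsList (T : StdYoungTableau n) {a : ℕ} :
    a ∈ T.rowsList.flatten ↔ ∃ i j, (i, j) ∈ T.shape ∧ T.entry i j = a := by
  simp only [rowsList, List.mem_flatten, List.mem_map, List.mem_range]
  constructor
  · rintro ⟨_, ⟨i, hi, rfl⟩, h⟩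
    obtain ⟨j, hj, rfl⟩ := List.mem_map.1 h
    exact ⟨i, j, YoungDiagram.mem_iff_lt_rowLen.2 (List.mem_range.1 hj), rfl⟩
  · rintro ⟨i, j, hij, rfl⟩
    have hj := YoungDiagram.mem_iff_lt_rowLen.1 hij
    exact ⟨_, ⟨i, T.lt_colLen_iff.2 (by omega), rfl⟩,
      List.mem_map.2 ⟨j, List.mem_range.2 hj, rfl⟩⟩

theorem entry_inj (T : StdYoungTableau n) {i j i' j' : ℕ} (h : (i, j) ∈ T.shape)
    (h' : (i', j') ∈ T.shape) (e : T.entry i j = T.entry i' j') : i = i' ∧ j = j' := by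
  simpa using T.bijOn.injOn (show (i, j) ∈ (T.shape.cells : Set (ℕ × ℕ)) from h)
    (show (i', j') ∈ (T.shape.cells : Set (ℕ × ℕ)) from h') e

theorem readingWord_rowsList_perm (T : StdYoungTableau n) :
    (readingWord T.rowsList).Perm (List.range' 1 n) := by
  refine (readingWord_perm_flatten _).trans ?_
  rw [List.perm_ext_iff_of_nodup ?_ List.nodup_range']
  · intro a
    rw [mem_flatten_rowsList, List.mem_range'_1]
    constructor
    · rintro ⟨i, j, h, rfl⟩
      have := T.entry_mem_Icc h
      omega
    · intro h
      obtain ⟨⟨i, j⟩, hc, e⟩ := T.bijOn.surjOn (show a ∈ Set.Icc 1 n from ⟨h.1, by omega⟩)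
      exact ⟨i, j, hc, e⟩
  · rw [List.nodup_flatten, rowsList, List.pairwise_map]
    constructor
    · intro l hl
      obtain ⟨i, -, rfl⟩ := List.mem_map.1 hl
      refine List.Nodup.map_on (fun a ha b hb e => ?_) List.nodup_range
      exact (T.entry_inj (YoungDiagram.mem_iff_lt_rowLen.2 (List.mem_range.1 ha))
        (YoungDiagram.mem_iff_lt_rowLen.2 (List.mem_range.1 hb)) e).2
    · refine List.pairwise_lt_range.imp fun {i i'} hi => ?_
      intro x hx hx'
      obtain ⟨a, ha, rfl⟩ := List.mem_map.1 hx
      obtain ⟨b, hb, e⟩ := List.mem_map.1 hx'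
      have := (T.entry_inj (YoungDiagram.mem_iff_lt_rowLen.2 (List.mem_range.1 ha))
        (YoungDiagram.mem_iff_lt_rowLen.2 (List.mem_range.1 hb)) e.symm).1
      omega

theorem mem_shape_iff (T : StdYoungTableau n) {i j : ℕ} : (i, j) ∈ T.shape ↔ T.entry i j ≠ 0 := by
  refine ⟨fun h => ?_, fun h => by_contra fun h' => h (T.zeros h')⟩
  have := T.entry_mem_Icc h
  omega

theorem eq_of_entry_eq {S T : StdYoungTableau n} (h : ∀ i j, S.entry i j = T.entry i j) :
    S = T := by
  refine StdYoungTableau.ext ?_ (funext fun i => funext (h i))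
  ext ⟨i, j⟩
  rw [YoungDiagram.mem_cells, YoungDiagram.mem_cells, mem_shape_iff, mem_shape_iff, h]

theorem eq_of_mem_knuthClass {S T : StdYoungTableau n} {w : Equiv.Perm (Fin n)}
    (hS : w ∈ S.knuthClass) (hT : w ∈ T.knuthClass) : S = T :=
  eq_of_entry_eq fun i j => (hS i j).symm.trans (hT i j)

end StdYoungTableau

/-! ### Knuth classes and the tableau order in terms of words -/

theorem flatten_insertionRows_perm {n : ℕ} (w : Equiv.Perm (Fin n)) :
    (insertionRows (permWord w)).flatten.Perm (List.range' 1 n) :=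
  ((readingWord_perm_flatten _).symm.trans
    (knuthEq_readingWord (permWord_nodup w)).perm.symm).trans (permWord_perm w)

namespace StdYoungTableau

variable {n : ℕ}

theorem mem_knuthClass_iff {T : StdYoungTableau n} {w : Equiv.Perm (Fin n)} :
    w ∈ T.knuthClass ↔ insertionRows (permWord w) = T.rowsList := by
  have key : ∀ {t : List (List ℕ)}, t.flatten.Perm (List.range' 1 n) → ∀ r ∈ t, 0 ∉ r := by
    intro t ht r hr h0
    have := ht.mem_iff.1 (List.mem_flatten.2 ⟨r, hr, h0⟩)
    rw [List.mem_range'_1] at this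
    omega
  constructor
  · intro h
    refine eq_of_rowsEntry_eq (isTableau_insertionRows _).nil_notMem
      T.isTableau_rowsList.nil_notMem (key (flatten_insertionRows_perm w))
      (key ((readingWord_perm_flatten _).symm.trans T.readingWord_rowsList_perm)) fun i j => ?_
    rw [h i j, rowsEntry_rowsList]
  · intro h i j
    rw [h, rowsEntry_rowsList]

theorem knuthEq_of_mem_knuthClass {T : StdYoungTableau n} {w : Equiv.Perm (Fin n)}
    (h : w ∈ T.knuthClass) : KnuthEq (permWord w) (readingWord T.rowsList) := by
  rw [← mem_knuthClass_iff.1 h]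
  exact knuthEq_readingWord (permWord_nodup w)

theorem exists_permWord_eq_readingWord (T : StdYoungTableau n) :
    ∃ w ∈ T.knuthClass, permWord w = readingWord T.rowsList := by
  obtain ⟨w, hw⟩ := exists_permWord_eq T.readingWord_rowsList_perm
  refine ⟨w, mem_knuthClass_iff.2 ?_, hw⟩
  rw [hw, T.isTableau_rowsList.insertionRows_readingWord]

/-- Every permutation lies in the Knuth class of its insertion tableau. -/
theorem exists_mem_knuthClass (w : Equiv.Perm (Fin n)) :
    ∃ T : StdYoungTableau n, w ∈ T.knuthClass := by
  have ht := isTableau_insertionRows (permWord w)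
  have hp := flatten_insertionRows_perm w
  generalize hw : insertionRows (permWord w) = t at ht hp
  have hnd : t.flatten.Nodup := hp.nodup_iff.2 List.nodup_range'
  rw [List.nodup_flatten] at hnd
  obtain ⟨hnd1, hnd2⟩ := hnd
  have hpw := ht.pairwise_rowAbove
  rw [List.pairwise_iff_getElem] at hpw hnd2
  have hanti : (t.map List.length).SortedGE := by
    rw [List.sortedGE_iff_pairwise, List.pairwise_map]
    exact ht.pairwise_rowAbove.imp RowAbove.length_le
  have hmem : ∀ {i j : ℕ}, (i, j) ∈ YoungDiagram.ofRowLens _ hanti ↔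
      ∃ h : i < t.length, j < t[i].length := by
    intro i j
    rw [YoungDiagram.mem_ofRowLens]
    simp
  have hent : ∀ {i j : ℕ} (hi : i < t.length) (hj : j < t[i].length),
      rowsEntry t i j = t[i][j] := by
    intro i j hi hj
    rw [rowsEntry, List.getD_eq_getElem _ _ hi, List.getD_eq_getElem _ _ hj]
  refine ⟨{ shape := YoungDiagram.ofRowLens _ hanti
            entry := rowsEntry t
            row_strict := ?_
            col_strict := ?_
            bijOn := ⟨?_, ?_, ?_⟩
            zeros := ?_ }, fun i j => by rw [hw]⟩
  · intro i j₁ j₂ hj hm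
    obtain ⟨hi, hj2⟩ := hmem.1 hm
    rw [hent hi (hj.trans hj2), hent hi hj2]
    have h1 := List.pairwise_iff_getElem.1 (ht.sorted _ (List.getElem_mem hi)) j₁ j₂
      (hj.trans hj2) hj2 hj
    refine lt_of_le_of_ne h1 fun e => hj.ne ?_
    exact (hnd1 _ (List.getElem_mem hi)).getElem_inj_iff.1 e
  · intro i₁ i₂ j hi hm
    obtain ⟨hi2, hj⟩ := hmem.1 hm
    rw [rowsEntry, rowsEntry, List.getD_eq_getElem _ _ hi2, List.getD_eq_getElem _ _ (hi.trans hi2)]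
    exact (hpw i₁ i₂ (hi.trans hi2) hi2 hi).getD_lt hj
  · rintro ⟨i, j⟩ hc
    obtain ⟨hi, hj⟩ := hmem.1 hc
    have := hp.mem_iff.1 (List.mem_flatten.2 ⟨_, List.getElem_mem hi, List.getElem_mem hj⟩)
    rw [List.mem_range'_1] at this
    simp only [hent hi hj, Set.mem_Icc]
    omega
  · rintro ⟨i, j⟩ hc ⟨i', j'⟩ hc' e
    obtain ⟨hi, hj⟩ := hmem.1 hc
    obtain ⟨hi', hj'⟩ := hmem.1 hc'
    simp only [hent hi hj, hent hi' hj'] at e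
    rcases lt_trichotomy i i' with h | rfl | h
    · exact (hnd2 i i' hi hi' h (List.getElem_mem hj) (e ▸ List.getElem_mem hj')).elim
    · rw [(hnd1 _ (List.getElem_mem hi)).getElem_inj_iff.1 e]
    · exact (hnd2 i' i hi' hi h (List.getElem_mem hj') (e ▸ List.getElem_mem hj)).elim
  · intro a ha
    have : a ∈ t.flatten := hp.mem_iff.2 (List.mem_range'_1.2 ⟨ha.1, by have := ha.2; omega⟩)
    obtain ⟨r, hr, ha⟩ := List.mem_flatten.1 this
    obtain ⟨i, hi, rfl⟩ := List.getElem_of_mem hr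
    obtain ⟨j, hj, rfl⟩ := List.getElem_of_mem ha
    exact ⟨(i, j), hmem.2 ⟨hi, hj⟩, hent hi hj⟩
  · intro i j hm
    rw [rowsEntry]
    by_cases hi : i < t.length
    · have hj : ¬ j < t[i].length := fun hj => hm (hmem.2 ⟨hi, hj⟩)
      rw [List.getD_eq_getElem _ _ hi, List.getD_eq_default _ _ (not_lt.1 hj)]
    · rw [List.getD_eq_default t _ (not_lt.1 hi)]
      simp

/-- Every intermediate word of a path is a permutation word with a tableau of its own; weak steps
are generating relations between these tableaux and Knuth moves do not change them. Quantifying over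
T lets the endpoint vary in the induction. -/
theorem le_of_wordLE {S : StdYoungTableau n} {σ : Equiv.Perm (Fin n)} (hσ : σ ∈ S.knuthClass)
    {v : List ℕ} (h : WordLE (permWord σ) v) :
    ∃ τ, permWord τ = v ∧ ∀ T : StdYoungTableau n, τ ∈ T.knuthClass → S ≤ T := by
  induction h with
  | refl => exact ⟨σ, rfl, fun T hT => (eq_of_mem_knuthClass hσ hT).le⟩
  | @tail u v _ h ih =>
    obtain ⟨τ, rfl, hτ⟩ := ih
    obtain ⟨τ', rfl⟩ := exists_permWord_eq (h.perm.symm.trans (permWord_perm τ))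
    obtain ⟨X, hX⟩ := exists_mem_knuthClass τ
    refine ⟨τ', rfl, fun T hT => (hτ X hX).trans ?_⟩
    rcases h with h | h
    · exact .single ⟨τ, hX, τ', hT, h.permWeakLE⟩
    · refine (eq_of_mem_knuthClass hX (mem_knuthClass_iff.2 ?_)).le
      rw [← h.insertionRows_eq, mem_knuthClass_iff.1 hT]

theorem le_iff_wordLE {S T : StdYoungTableau n} :
    S ≤ T ↔ WordLE (readingWord S.rowsList) (readingWord T.rowsList) := by
  constructor
  · intro h
    induction h with
    | refl => exact .refl
    | tail _ h ih =>
      obtain ⟨σ, hσ, τ, hτ, h⟩ := h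
      exact ih.trans ((knuthEq_of_mem_knuthClass hσ).wordLE.2.trans
        (h.wordLE.trans (knuthEq_of_mem_knuthClass hτ).wordLE.1))
  · intro h
    obtain ⟨σ, hσ, e⟩ := S.exists_permWord_eq_readingWord
    obtain ⟨τ, hτ, e'⟩ := T.exists_permWord_eq_readingWord
    rw [← e] at h
    obtain ⟨τ', h1, h2⟩ := le_of_wordLE hσ h
    obtain rfl := permWord_injective (h1.trans e'.symm)
    exact h2 T hτ

/-! ### Inner tableaux of shape `(2, 1)` -/

theorem innerTranslation_innerTranslation {k n : ℕ} (h : k ≤ n) {R R' : StdYoungTableau k}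
    (hs : R.shape = R'.shape) (T : WithInner h R) :
    innerTranslation h hs.symm (innerTranslation h hs T) = T := by
  refine Subtype.ext (eq_of_entry_eq fun i j => ?_)
  have hle : R'.entry i j ≤ k := by
    by_cases hm : (i, j) ∈ R'.shape
    · exact (R'.entry_mem_Icc hm).2
    · rw [R'.zeros hm]; exact Nat.zero_le k
  have hT : R.entry i j = if T.1.entry i j ≤ k then T.1.entry i j else 0 := by
    conv_lhs => rw [← T.2]
    rfl
  change (if (if T.1.entry i j ≤ k then R'.entry i j else T.1.entry i j) ≤ k then R.entry i j
    else (if T.1.entry i j ≤ k then R'.entry i j else T.1.entry i j)) = T.1.entry i j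
  by_cases h1 : T.1.entry i j ≤ k
  · rw [if_pos h1, if_pos hle, hT, if_pos h1]
  · simp [h1]

/-- Inner tableau translation as a bijection. -/
def innerTranslationEquiv {k n : ℕ} (h : k ≤ n) {R R' : StdYoungTableau k}
    (hs : R.shape = R'.shape) : WithInner h R ≃ WithInner h R' where
  toFun := innerTranslation h hs
  invFun := innerTranslation h hs.symm
  left_inv := innerTranslation_innerTranslation h hs
  right_inv := innerTranslation_innerTranslation h hs.symm

/-- The two inner tableaux differ by exchanging 2 and 3, and the exchange also fixes the value 0
outside the shape. -/
theorem innerTranslation_entry {h : 3 ≤ n} (T : WithInner h tableau13_2) (i j : ℕ) :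
    (innerTranslation h shape_tableau13_2 T).1.entry i j = Equiv.swap 2 3 (T.1.entry i j) := by
  have hT : tableau13_2.entry i j = if T.1.entry i j ≤ 3 then T.1.entry i j else 0 := by
    conv_lhs => rw [← T.2]
    rfl
  change (if T.1.entry i j ≤ 3 then tableau12_3.entry i j else T.1.entry i j) = _
  split_ifs with h1
  · rw [if_pos h1] at hT
    rw [← hT]
    simp only [tableau13_2, tableau12_3, tableau21]
    split_ifs <;> rfl
  · exact (swap_of_lt (by simp) le_rfl (by omega)).symm

theorem readingWord_innerTranslation {h : 3 ≤ n} (T : WithInner h tableau13_2) :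
    readingWord (innerTranslation h shape_tableau13_2 T).1.rowsList =
      (readingWord T.1.rowsList).map (Equiv.swap 2 3) := by
  rw [← readingWord_map, rowsList, rowsList, List.map_map]
  congr 1
  refine List.map_congr_left fun i _ => ?_
  rw [Function.comp_apply, List.map_map]
  exact List.map_congr_left fun j _ => innerTranslation_entry T i j

theorem smallLetters_readingWord (t : List (List ℕ)) :
    smallLetters (readingWord t) = readingWord (t.map smallLetters) := by
  induction t with
  | nil => rfl
  | cons r rs ih => rw [readingWord, smallLetters_append, ih]; rfl

theorem smallLetters_reading_of_inner {h : 3 ≤ n} (T : WithInner h tableau13_2) :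
    smallLetters (readingWord T.1.rowsList) = [2, 1, 3] := by
  obtain ⟨T, hT⟩ := T
  have hmem : ∀ {i j : ℕ}, (i, j) ∈ diagram21 ↔ (i, j) ∈ T.shape ∧ T.entry i j ≤ 3 := by
    intro i j
    rw [← mem_restrict_shape h, hT]
    rfl
  have hent : ∀ {i j : ℕ}, (i, j) ∈ diagram21 → T.entry i j = tableau13_2.entry i j := by
    intro i j hm
    rw [← hT]
    exact (if_pos (hmem.1 hm).2).symm
  -- The map f shifts the column index, so that this covers what is left of a row once its inner
  -- cells are split off.
  have hbig : ∀ i (f : ℕ → ℕ) q, (∀ j < q, (i, f j) ∈ T.shape ∧ (i, f j) ∉ diagram21) →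
      smallLetters ((List.range q).map fun j => T.entry i (f j)) = [] := by
    intro i f q hq
    rw [smallLetters_eq_nil]
    intro a ha
    obtain ⟨j, hj, rfl⟩ := List.mem_map.1 ha
    have := hq j (List.mem_range.1 hj)
    by_contra hc
    exact this.2 (hmem.2 ⟨this.1, not_lt.1 hc⟩)
  have h00 := mem_diagram21.2 (.inl ⟨rfl, rfl⟩)
  have h01 := mem_diagram21.2 (.inr (.inl ⟨rfl, rfl⟩))
  have h10 := mem_diagram21.2 (.inr (.inr ⟨rfl, rfl⟩))
  have r0 := YoungDiagram.mem_iff_lt_rowLen.1 (hmem.1 h01).1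
  have r1 := YoungDiagram.mem_iff_lt_rowLen.1 (hmem.1 h10).1
  have c0 := YoungDiagram.mem_iff_lt_colLen.1 (hmem.1 h10).1
  have e00 : T.entry 0 0 = 1 := hent h00
  have e01 : T.entry 0 1 = 3 := hent h01
  have e10 : T.entry 1 0 = 2 := hent h10
  have row0 : smallLetters ((List.range (T.shape.rowLen 0)).map (T.entry 0)) = [1, 3] := by
    obtain ⟨p, hp⟩ : ∃ p, T.shape.rowLen 0 = p + 2 := ⟨T.shape.rowLen 0 - 2, by omega⟩
    rw [hp, List.range_succ_eq_map, List.range_succ_eq_map]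
    simp only [List.map_cons, List.map_map, zero_add, Nat.succ_eq_add_one]
    rw [e00, e01, smallLetters_cons_of_le (by simp), smallLetters_cons_of_le le_rfl]
    congr 2
    refine hbig 0 (fun j => j + 1 + 1) p fun j hj => ⟨?_, ?_⟩
    · rw [YoungDiagram.mem_iff_lt_rowLen]; omega
    · rw [mem_diagram21]; omega
  have row1 : smallLetters ((List.range (T.shape.rowLen 1)).map (T.entry 1)) = [2] := by
    obtain ⟨p, hp⟩ : ∃ p, T.shape.rowLen 1 = p + 1 := ⟨T.shape.rowLen 1 - 1, by omega⟩
    rw [hp, List.range_succ_eq_map]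
    simp only [List.map_cons, List.map_map]
    rw [e10, smallLetters_cons_of_le (by simp)]
    congr 1
    refine hbig 1 (fun j => j + 1) p fun j hj => ⟨?_, ?_⟩
    · rw [YoungDiagram.mem_iff_lt_rowLen]; omega
    · rw [mem_diagram21]; omega
  have hnil : ∀ t : List (List ℕ), (∀ r ∈ t, r = []) → readingWord t = [] := by
    intro t ht
    induction t with
    | nil => rfl
    | cons r rs ih => rw [readingWord, ih fun r hr => ht r (by simp [hr]), ht r (by simp)]; rfl
  rw [smallLetters_readingWord, rowsList, List.map_map]
  obtain ⟨p, hp⟩ : ∃ p, T.shape.colLen 0 = p + 2 := ⟨T.shape.colLen 0 - 2, by omega⟩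
  rw [hp, List.range_succ_eq_map, List.range_succ_eq_map]
  simp only [List.map_cons, List.map_map, zero_add, Nat.succ_eq_add_one, readingWord,
    Function.comp_apply]
  rw [row0, row1, hnil]
  · rfl
  · intro r hr
    obtain ⟨i, -, rfl⟩ := List.mem_map.1 hr
    refine hbig (i + 1 + 1) (fun j => j) _ fun j hj => ⟨?_, ?_⟩
    · exact YoungDiagram.mem_iff_lt_rowLen.2 hj
    · rw [mem_diagram21]; omega

theorem innerTranslation_le_iff {h : 3 ≤ n} (S T : WithInner h tableau13_2) :
    innerTranslation h shape_tableau13_2 S ≤ innerTranslation h shape_tableau13_2 T ↔ S ≤ T := by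
  rw [← Subtype.coe_le_coe, ← Subtype.coe_le_coe, le_iff_wordLE, le_iff_wordLE]
  have key : ∀ T : WithInner h tableau13_2,
      readingWord (innerTranslation h shape_tableau13_2 T).1.rowsList =
        dualKnuth (readingWord T.1.rowsList) := fun T => by
    rw [readingWord_innerTranslation, dualKnuth, if_pos (smallLetters_reading_of_inner T)]
  rw [key, key]
  exact wordLE_dualKnuth_iff (.inl (smallLetters_reading_of_inner S))
    (.inl (smallLetters_reading_of_inner T))
    (S.1.readingWord_rowsList_perm.nodup_iff.2 List.nodup_range')
    (T.1.readingWord_rowsList_perm.nodup_iff.2 List.nodup_range')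

end StdYoungTableau

theorem mainTheorem4 (n : ℕ) (hn : 3 < n)
    (S T : StdYoungTableau.WithInner hn.le StdYoungTableau.tableau13_2) :
    S ⋖ T ↔
      StdYoungTableau.innerTranslation hn.le StdYoungTableau.shape_tableau13_2 S ⋖
        StdYoungTableau.innerTranslation hn.le StdYoungTableau.shape_tableau13_2 T := by
  have hle := StdYoungTableau.innerTranslation_le_iff (h := hn.le)
  have hlt : ∀ S T : StdYoungTableau.WithInner hn.le StdYoungTableau.tableau13_2,
      StdYoungTableau.innerTranslation hn.le StdYoungTableau.shape_tableau13_2 S <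
        StdYoungTableau.innerTranslation hn.le StdYoungTableau.shape_tableau13_2 T ↔ S < T := by
    intro S T
    rw [lt_iff_le_not_ge, lt_iff_le_not_ge, hle, hle]
  -- Surjectivity pulls an element lying strictly between the images back to one between S and T.
  have hsurj := (StdYoungTableau.innerTranslationEquiv hn.le
    StdYoungTableau.shape_tableau13_2).surjective
  rw [CovBy, CovBy, hlt]
  refine and_congr_right fun _ => ⟨fun h c => ?_, fun h c hc hc' => ?_⟩
  · obtain ⟨c, rfl⟩ := hsurj c
    intro hc hc'
    exact h ((hlt _ _).1 hc) ((hlt _ _).1 hc')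
  · exact h ((hlt _ _).2 hc) ((hlt _ _).2 hc')
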